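/- Let $\Bbbk$ be a field of characteristic $0$ and let $A$ be a commutative (associative, unital) $\Bbbk$-algebra. A Lie–Rinehart algebra over $A$ is a $\Bbbk$-Lie algebra $\mathfrak g$ with an $A$-module structure (extending its $\Bbbk$-vector space structure) and a morphism of Lie algebras $\omega\colon\mathfrak g\to\mathrm{Der}_{\Bbbk}(A)$ such that $\omega(aX)=a\,\omega(X)$ and $[X,aY]=a[X,Y]+\omega(X)(a)\,Y$ for all $a\in A$ and $X,Y\in\mathfrak g$. Its universal enveloping algebra $\mathcal U_A(\mathfrak g)$ is the universal $\Bbbk$-algebra equipped with a morphism of $\Bbbk$-algebras $\iota_A\colon A\to\mathcal U_A(\mathfrak g)$ and a morphism of $\Bbbk$-Lie algebras $\iota_{\mathfrak g}\colon\mathfrak g\to\mathcal U_A(\mathfrak g)$ (with the commutator bracket on the target) such that $\iota_{\mathfrak g}(aX)=\iota_A(a)\iota_{\mathfrak g}(X)$ and $\iota_{\mathfrak g}(X)\iota_A(a)-\iota_A(a)\iota_{\mathfrak g}(X)=\iota_A(\omega(X)(a))$ for all $a\in A$, $X\in\mathfrak g$. Let $\mathfrak g$ be a Lie–Rinehart algebra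 over $A$ and let $\mathfrak h\subseteq\mathfrak g$ be a Lie–Rinehart subalgebra, that is, an $A$-submodule closed under the bracket, with the restricted anchor. Suppose that the $A$-modules $\mathfrak h$, $\mathfrak g$ and $\mathfrak g/\mathfrak h$ are projective. Then there is an isomorphism $$\mathcal U_A(\mathfrak g)\;\cong\;\mathcal U_A(\mathfrak h)\otimes_A\mathcal S_A(\mathfrak g/\mathfrak h)$$ of left $\mathcal U_A(\mathfrak h)$-modules. Here $\mathcal S_A(\mathfrak g/\mathfrak h)$ is the symmetric algebra of the $A$-module $\mathfrak g/\mathfrak h$; the tensor product is formed with respect to the right $A$-module structure $u\cdot a=u\,\iota_A(a)$ on $\mathcal U_A(\mathfrak h)$; $\mathcal U_A(\mathfrak h)$ acts on the tensor product by left multiplication on the first factor, and on $\mathcal U_A(\mathfrak g)$ by left multiplication through the algebra morphism $\mathcal U_A(\mathfrak h)\to\mathcal U_A(\mathfrak g)$ induced by the inclusion. In particular, $\mathcal U_A(\mathfrak g)$ is a projective left $\mathcal U_A(\mathfrak h)$-module. -/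

import Mathlib

open scoped TensorProduct LieRinehartAlgebra

noncomputable section

namespace LieRinehartUEA

section Construction

variable (k A L : Type*) [CommRing k] [CommRing A] [Algebra k A] [LieRing L] [LieAlgebra k L]
  [Module A L] [LieRingModule L A]

/-- The defining relations of the universal enveloping algebra of a Lie-Rinehart algebra `(A, L)`,
imposed on the tensor `k`-algebra of the `k`-module `A × L`: the map `a ↦ (a, 0)` becomes a
morphism of `k`-algebras, the map `x ↦ (0, x)` becomes a morphism of Lie algebras, and the two maps
are compatible with the `A`-module structure of `L` and with the anchor `x ↦ (a ↦ ⁅x, a⁆)`. -/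
inductive Rel : TensorAlgebra k (A × L) → TensorAlgebra k (A × L) → Prop
  | one : Rel (TensorAlgebra.ι k ((1 : A), (0 : L))) 1
  | mul (a b : A) : Rel (TensorAlgebra.ι k (a * b, (0 : L)))
      (TensorAlgebra.ι k (a, (0 : L)) * TensorAlgebra.ι k (b, (0 : L)))
  | lie (x y : L) : Rel (TensorAlgebra.ι k ((0 : A), ⁅x, y⁆))
      (TensorAlgebra.ι k ((0 : A), x) * TensorAlgebra.ι k ((0 : A), y) -
        TensorAlgebra.ι k ((0 : A), y) * TensorAlgebra.ι k ((0 : A), x))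
  | smul (a : A) (x : L) : Rel (TensorAlgebra.ι k ((0 : A), a • x))
      (TensorAlgebra.ι k (a, (0 : L)) * TensorAlgebra.ι k ((0 : A), x))
  | anchor (x : L) (a : A) : Rel (TensorAlgebra.ι k (⁅x, a⁆, (0 : L)))
      (TensorAlgebra.ι k ((0 : A), x) * TensorAlgebra.ι k (a, (0 : L)) -
        TensorAlgebra.ι k (a, (0 : L)) * TensorAlgebra.ι k ((0 : A), x))

/-- The universal enveloping algebra `U_A(L)` of a Lie-Rinehart algebra `(A, L)` over `k`.
Its universal property is given by `lift`, `lift_ιA`, `lift_ιL` and `hom_ext`. -/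
def UEA : Type _ := RingQuot (Rel k A L)

instance : Ring (UEA k A L) := inferInstanceAs (Ring (RingQuot (Rel k A L)))

instance : Algebra k (UEA k A L) := inferInstanceAs (Algebra k (RingQuot (Rel k A L)))

/-- The quotient map from the tensor algebra. -/
def mk : TensorAlgebra k (A × L) →ₐ[k] UEA k A L := RingQuot.mkAlgHom k (Rel k A L)

variable {k A L} in
theorem mk_rel {s t : TensorAlgebra k (A × L)} (h : Rel k A L s t) :
    mk k A L s = mk k A L t := RingQuot.mkAlgHom_rel k h

/-- The canonical morphism of `k`-algebras `A → U_A(L)`. -/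
def ιA : A →ₐ[k] UEA k A L :=
  AlgHom.ofLinearMap
    ((mk k A L).toLinearMap ∘ₗ TensorAlgebra.ι k ∘ₗ LinearMap.inl k A L)
    (by simpa using mk_rel (Rel.one (k := k) (A := A) (L := L)))
    (fun a b => by simpa using mk_rel (Rel.mul (k := k) (L := L) a b))

/-- The canonical map `L → U_A(L)`; by `ιL_lie` it is a morphism of Lie algebras over `k`. -/
def ιL : L →ₗ[k] UEA k A L :=
  (mk k A L).toLinearMap ∘ₗ TensorAlgebra.ι k ∘ₗ LinearMap.inr k A L

theorem ιA_apply (a : A) : ιA k A L a = mk k A L (TensorAlgebra.ι k (a, (0 : L))) := rfl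

theorem ιL_apply (x : L) : ιL k A L x = mk k A L (TensorAlgebra.ι k ((0 : A), x)) := rfl

theorem ιL_lie (x y : L) :
    ιL k A L ⁅x, y⁆ = ιL k A L x * ιL k A L y - ιL k A L y * ιL k A L x := by
  simpa [ιA_apply, ιL_apply] using mk_rel (Rel.lie (k := k) (A := A) x y)

theorem ιL_smul (a : A) (x : L) : ιL k A L (a • x) = ιA k A L a * ιL k A L x := by
  simpa [ιA_apply, ιL_apply] using mk_rel (Rel.smul (k := k) a x)

theorem ιL_mul_ιA_sub (x : L) (a : A) :
    ιL k A L x * ιA k A L a - ιA k A L a * ιL k A L x = ιA k A L ⁅x, a⁆ := by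
  simpa [ιA_apply, ιL_apply] using (mk_rel (Rel.anchor (k := k) x a)).symm

variable {k A L}

section Lift

variable {B : Type*} [Ring B] [Algebra k B] (f : A →ₐ[k] B) (g : L →ₗ[k] B)
  (hlie : ∀ x y : L, g ⁅x, y⁆ = g x * g y - g y * g x)
  (hsmul : ∀ (a : A) (x : L), g (a • x) = f a * g x)
  (hanchor : ∀ (x : L) (a : A), g x * f a - f a * g x = f ⁅x, a⁆)

/-- Existence part of the universal property of `U_A(L)`. -/
def lift : UEA k A L →ₐ[k] B :=
  RingQuot.liftAlgHom k ⟨TensorAlgebra.lift k (f.toLinearMap.coprod g), by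
    intro s t h
    induction h with
    | one => simp
    | mul a b => simp
    | lie x y => simp [hlie]
    | smul a x => simp [hsmul]
    | anchor x a => simp [hanchor]⟩

@[simp]
theorem lift_ιA (a : A) : lift f g hlie hsmul hanchor (ιA k A L a) = f a := by
  exact (RingQuot.liftAlgHom_mkAlgHom_apply _ _ _ _).trans (by simp)

@[simp]
theorem lift_ιL (x : L) : lift f g hlie hsmul hanchor (ιL k A L x) = g x := by
  exact (RingQuot.liftAlgHom_mkAlgHom_apply _ _ _ _).trans (by simp)

end Lift

/-- Uniqueness part of the universal property of `U_A(L)`. -/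
theorem hom_ext {B : Type*} [Ring B] [Algebra k B] {F G : UEA k A L →ₐ[k] B}
    (hA : ∀ a, F (ιA k A L a) = G (ιA k A L a)) (hL : ∀ x, F (ιL k A L x) = G (ιL k A L x)) :
    F = G := by
  apply RingQuot.ringQuot_ext'
  apply TensorAlgebra.hom_ext
  ext x
  · exact hA x
  · exact hL x

/-- The morphism `U_A(f) : U_A(L) → U_A(L')` induced by a morphism of Lie-Rinehart algebras over
the same base algebra `A`. -/
def map {L' : Type*} [LieRing L'] [LieAlgebra k L'] [Module A L'] [LieRingModule L' A]
    (f : L →ₗ⁅AlgHom.id k A⁆ L') : UEA k A L →ₐ[k] UEA k A L' :=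
  lift (ιA k A L') (ιL k A L' ∘ₗ (f.toLieHom : L →ₗ[k] L'))
    (fun x y => by simp [ιL_lie])
    (fun a x => by
      have h := f.map_smul_apply' a x
      simp only [LinearMap.comp_apply, LieHom.coe_toLinearMap, h, AlgHom.id_apply, ιL_smul])
    (fun x a => by
      have h := f.apply_lie' a x
      simp only [AlgHom.id_apply] at h
      simp only [LinearMap.comp_apply, LieHom.coe_toLinearMap, ιL_mul_ιA_sub, h])

@[simp]
theorem map_ιA {L' : Type*} [LieRing L'] [LieAlgebra k L'] [Module A L'] [LieRingModule L' A]
    (f : L →ₗ⁅AlgHom.id k A⁆ L') (a : A) : map f (ιA k A L a) = ιA k A L' a := by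
  simp [map]

@[simp]
theorem map_ιL {L' : Type*} [LieRing L'] [LieAlgebra k L'] [Module A L'] [LieRingModule L' A]
    (f : L →ₗ⁅AlgHom.id k A⁆ L') (x : L) : map f (ιL k A L x) = ιL k A L' (f x) := by
  simp [map]

end Construction

section RightRegular

variable (k A L : Type*) [CommRing k] [CommRing A] [Algebra k A] [LieRing L] [LieAlgebra k L]
  [Module A L] [LieRingModule L A]

/-- `U_A(L)` viewed as a `(U_A(L), A)`-bimodule: `U_A(L)` acts by left multiplication and the
commutative algebra `A` acts by right multiplication, `a • u = u * ιA a`. The tensor product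
`RightReg k A L ⊗[A] M` is thus formed with respect to the right `A`-module structure of `U_A(L)`,
and it is a left `U_A(L)`-module through its left factor. -/
def RightReg : Type _ := UEA k A L

instance : AddCommGroup (RightReg k A L) := inferInstanceAs (AddCommGroup (UEA k A L))

instance : Module (UEA k A L) (RightReg k A L) :=
  inferInstanceAs (Module (UEA k A L) (UEA k A L))

instance : Module A (RightReg k A L) where
  smul a u := ((show UEA k A L from u) * ιA k A L a : UEA k A L)
  one_smul u := by
    change (show UEA k A L from u) * ιA k A L 1 = u
    rw [map_one, mul_one]
  mul_smul a b u := by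
    change (show UEA k A L from u) * ιA k A L (a * b) =
      ((show UEA k A L from u) * ιA k A L b) * ιA k A L a
    rw [mul_comm a b, map_mul, mul_assoc]
  smul_zero a := zero_mul (ιA k A L a)
  smul_add a u v := add_mul (show UEA k A L from u) (show UEA k A L from v) (ιA k A L a)
  add_smul a b u := by
    change (show UEA k A L from u) * ιA k A L (a + b) =
      (show UEA k A L from u) * ιA k A L a + (show UEA k A L from u) * ιA k A L b
    rw [map_add, mul_add]
  zero_smul u := by
    change (show UEA k A L from u) * ιA k A L 0 = 0
    rw [map_zero, mul_zero]

instance : SMulCommClass A (UEA k A L) (RightReg k A L) where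
  smul_comm a u v := mul_assoc u (show UEA k A L from v) (ιA k A L a)

end RightRegular

section Subalgebra

variable {k A L : Type*} [CommRing k] [CommRing A] [Algebra k A] [LieRing L] [LieAlgebra k L]
  [Module A L] [LieRingModule L A] [LieRinehartRing A L] [LieRinehartAlgebra k A L]

/-- For a Lie-Rinehart subalgebra `H` of `L`, the algebra `U_A(L)` is a left `U_A(H)`-module by
left multiplication along the morphism `U_A(H) → U_A(L)` induced by the inclusion. -/
instance (H : LieRinehartSubalgebra A L) : Module (UEA k A H) (UEA k A L) :=
  Module.compHom (UEA k A L) (map (H.incl k)).toRingHom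

end Subalgebra

end LieRinehartUEA

end

/-!
A connection on a module over `A` is a family of operators obeying the Leibniz rule with respect to
the anchor. Connections exist on projective modules, and on `S(W)` they can be averaged so as to
preserve gradings.

A connection on `S(L)` whose symbol is multiplication is `x ↦ C x + x + B x`, where `C` is a graded
connection. Its flatness is an equation for the antisymmetric part of `B` in each degree in terms of
`B` in lower degrees. Averaging over the factors of a product turns this equation into a fixed point
problem for a contraction, and the Bianchi identity shows that the fixed point is flat. Hence
`U_A(L)` acts on `S(L)`.

Let `Ψ : M → S(W)` intertwine an action on `M` with operators on `S(W)` whose symbol is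
multiplication. Let `S(W)` be graded by an idempotent of `W`, and suppose that `Ψ` has a section
over the part of weight zero whose image generates `M`. This section extends to a symmetrization map
`φ : S(W) → M`. The image of `φ` is stable under the action, so `φ` is surjective, and `Ψ ∘ φ` is
the identity up to lower degrees. Hence `Ψ` is bijective. For `M = U_A(L)` this gives the
Poincaré–Birkhoff–Witt isomorphism `U_A(L) ≅ S(L)`. For the `U_A(H)`-module `M` induced by
`S(L/H)`, mapped to `S(L) ≅ U_A(L)`, it gives the theorem.
-/

noncomputable section

namespace LieRinehartPBW

open Polynomial LieRinehartUEA
open SymmetricAlgebra (ι lift_ι_apply)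

section Grading

variable {A W : Type*} [CommRing A] [AddCommGroup W] [Module A W]

@[elab_as_elim]
theorem induction_ι_mul {motive : SymmetricAlgebra A W → Prop} (one : motive 1)
    (smul : ∀ (a : A) q, motive q → motive (a • q))
    (mul : ∀ y q, motive q → motive (ι A W y * q))
    (add : ∀ p q, motive p → motive q → motive (p + q)) (q : SymmetricAlgebra A W) :
    motive q := by
  suffices h : ∀ p q : SymmetricAlgebra A W, motive q → motive (p * q) by simpa using h q 1 one
  intro p
  induction p using SymmetricAlgebra.induction with
  | algebraMap r => intro q hq; rw [← Algebra.smul_def]; exact smul r q hq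
  | ι x => exact mul x
  | mul a b ha hb => intro q hq; rw [mul_assoc]; exact ha _ (hb _ hq)
  | add a b ha hb => intro q hq; rw [add_mul]; exact add _ _ (ha _ hq) (hb _ hq)

/-- The algebra morphism `S(W) → S(W)[X]` with `y ↦ (y - e y) + (e y) X`. For an idempotent `e` it
encodes the grading of `S(W)` in which the image of `e` has weight one and its kernel has weight
zero; for `e = 1` this is the grading by degree. -/
def weightHom (e : Module.End A W) : SymmetricAlgebra A W →ₐ[A] (SymmetricAlgebra A W)[X] :=
  SymmetricAlgebra.lift
    ((CAlgHom (R := A) (A := SymmetricAlgebra A W)).toLinearMap ∘ₗ ι A W ∘ₗ (1 - e) +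
      LinearMap.mulRight A (X : (SymmetricAlgebra A W)[X]) ∘ₗ
        (CAlgHom (R := A) (A := SymmetricAlgebra A W)).toLinearMap ∘ₗ ι A W ∘ₗ e)

theorem weightHom_ι (e : Module.End A W) (y : W) :
    weightHom e (ι A W y) = C (ι A W (y - e y)) + C (ι A W (e y)) * X := by
  rw [weightHom, lift_ι_apply]
  simp [CAlgHom]

/-- The projection of `S(W)` to its component of weight `i` for the grading given by `e`. -/
def weightProj (e : Module.End A W) (i : ℕ) : SymmetricAlgebra A W →ₗ[A] SymmetricAlgebra A W :=
  (lcoeff (SymmetricAlgebra A W) i).restrictScalars A ∘ₗ (weightHom e).toLinearMap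

theorem weightProj_apply (e : Module.End A W) (i : ℕ) (q : SymmetricAlgebra A W) :
    weightProj e i q = (weightHom e q).coeff i := rfl

theorem weightProj_zero_one (e : Module.End A W) :
    weightProj e 0 (1 : SymmetricAlgebra A W) = 1 := by
  simp [weightProj_apply]

theorem weightProj_succ_one (e : Module.End A W) (i : ℕ) :
    weightProj e (i + 1) (1 : SymmetricAlgebra A W) = 0 := by
  simp [weightProj_apply, coeff_one]

theorem weightProj_zero_ι_mul (e : Module.End A W) (y : W) (q : SymmetricAlgebra A W) :
    weightProj e 0 (ι A W y * q) = ι A W (y - e y) * weightProj e 0 q := by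
  simp only [weightProj_apply, map_mul, weightHom_ι, add_mul, coeff_add, coeff_C_mul, mul_assoc,
    coeff_X_mul_zero, mul_zero, add_zero]

theorem weightProj_succ_ι_mul (e : Module.End A W) (i : ℕ) (y : W) (q : SymmetricAlgebra A W) :
    weightProj e (i + 1) (ι A W y * q) =
      ι A W (y - e y) * weightProj e (i + 1) q + ι A W (e y) * weightProj e i q := by
  simp only [weightProj_apply, map_mul, weightHom_ι, add_mul, coeff_add, coeff_C_mul, mul_assoc,
    coeff_X_mul]

theorem weightProj_comm {e e' : Module.End A W} (h : Commute e e') (i j : ℕ)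
    (q : SymmetricAlgebra A W) :
    weightProj e i (weightProj e' j q) = weightProj e' j (weightProj e i q) := by
  have h (y) : e (e' y) = e' (e y) := LinearMap.congr_fun h.eq y
  induction q using induction_ι_mul generalizing i j with
  | one => cases i <;> cases j <;> simp [weightProj_zero_one, weightProj_succ_one]
  | smul a q hq => simp only [map_smul, hq]
  | add p q hp hq => simp only [map_add, hp, hq]
  | mul y q hq =>
    cases i <;> cases j <;>
      simp only [weightProj_zero_ι_mul, weightProj_succ_ι_mul, map_add, hq] <;>
      simp only [map_sub, h] <;> ring

theorem weightProj_weightProj {e : Module.End A W} (he : IsIdempotentElem e) (i j : ℕ)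
    (q : SymmetricAlgebra A W) :
    weightProj e i (weightProj e j q) = if i = j then weightProj e j q else 0 := by
  have he (y) : e (e y) = e y := LinearMap.congr_fun he y
  induction q using induction_ι_mul generalizing i j with
  | one => cases i <;> cases j <;> simp [weightProj_zero_one, weightProj_succ_one]
  | smul a q hq => simp only [map_smul, hq]; split_ifs <;> simp
  | add p q hp hq => simp only [map_add, hp, hq]; split_ifs <;> simp
  | mul y q hq =>
    cases i <;> cases j <;>
      simp only [weightProj_zero_ι_mul, weightProj_succ_ι_mul, map_add, hq] <;>
      simp only [map_sub, he, sub_self, sub_zero, zero_mul, add_zero, zero_add,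
        Nat.add_right_cancel_iff, map_zero, reduceCtorEq, if_true, if_false, mul_zero]
    split_ifs <;> simp

theorem weightProj_self {e : Module.End A W} (he : IsIdempotentElem e) (i : ℕ)
    (q : SymmetricAlgebra A W) : weightProj e i (weightProj e i q) = weightProj e i q := by
  rw [weightProj_weightProj he, if_pos rfl]

theorem sum_weightProj (e : Module.End A W) (q : SymmetricAlgebra A W) :
    ∑ i ∈ Finset.range ((weightHom e q).natDegree + 1), weightProj e i q = q := by
  have h : ((aeval (1 : SymmetricAlgebra A W)).restrictScalars A).comp (weightHom e) =
      AlgHom.id A _ := by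
    apply SymmetricAlgebra.algHom_ext
    ext y
    simp [weightHom_ι]
  simpa only [AlgHom.comp_apply, AlgHom.restrictScalars_apply, AlgHom.id_apply,
    aeval_eq_sum_range, one_pow, smul_eq_mul, mul_one, weightProj_apply] using
    DFunLike.congr_fun h q

@[elab_as_elim]
theorem induction_weight (e : Module.End A W) {motive : SymmetricAlgebra A W → Prop}
    (q : SymmetricAlgebra A W) (zero : motive 0)
    (add : ∀ p q, motive p → motive q → motive (p + q))
    (proj : ∀ i, motive (weightProj e i q)) : motive q := by
  rw [← sum_weightProj e q]
  exact Finset.sum_induction _ motive add zero fun i _ => proj i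

section Gather

variable {R M : Type*} [Semiring R] [Module R (SymmetricAlgebra A W)]
  [LinearMap.CompatibleSMul (SymmetricAlgebra A W) (SymmetricAlgebra A W)[X] R A]
  [AddCommGroup M] [Module R M]

/-- The map acting by `f i` on the component of weight `i`. The scalars `R` are `A` when the `f i`
are `A`-linear and `ℤ` when they are only additive. -/
def gather (e : Module.End A W) (f : ℕ → SymmetricAlgebra A W →ₗ[R] M) :
    SymmetricAlgebra A W →ₗ[R] M :=
  lsum f ∘ₗ (weightHom e).toLinearMap.restrictScalars R

theorem gather_weightProj {e : Module.End A W} (he : IsIdempotentElem e)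
    (f : ℕ → SymmetricAlgebra A W →ₗ[R] M) (i : ℕ) (q : SymmetricAlgebra A W) :
    gather e f (weightProj e i q) = f i (weightProj e i q) := by
  have h : weightHom e (weightProj e i q) = monomial i (weightProj e i q) := by
    ext j
    rw [← weightProj_apply, weightProj_weightProj he, coeff_monomial]
    simp only [eq_comm]
  rw [gather, LinearMap.comp_apply, LinearMap.restrictScalars_apply, AlgHom.toLinearMap_apply, h]
  exact sum_monomial_index _ (fun i c => f i c) (map_zero _)

end Gather

/-- The elements of `S(W)` all of whose components have weight less than `n`. -/
def weightLT (e : Module.End A W) (n : ℕ) : Submodule A (SymmetricAlgebra A W) :=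
  ((Polynomial.degreeLT (SymmetricAlgebra A W) n).restrictScalars A).comap (weightHom e).toLinearMap

variable (A W) in
/-- The elements of `S(W)` of degree less than `n`. -/
abbrev degreeLT (n : ℕ) : Submodule A (SymmetricAlgebra A W) := weightLT 1 n

theorem mem_weightLT {e : Module.End A W} {n : ℕ} {q : SymmetricAlgebra A W} :
    q ∈ weightLT e n ↔ ∀ m, n ≤ m → weightProj e m q = 0 := by
  simp only [weightLT, Submodule.mem_comap, Submodule.restrictScalars_mem, Polynomial.mem_degreeLT,
    AlgHom.toLinearMap_apply, degree_lt_iff_coeff_zero, weightProj_apply]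

theorem weightLT_mono (e : Module.End A W) : Monotone (weightLT e) := fun _ _ h _ hq =>
  mem_weightLT.2 fun i hi => mem_weightLT.1 hq i (h.trans hi)

theorem weightLT_le_succ (e : Module.End A W) (n : ℕ) : weightLT e n ≤ weightLT e (n + 1) :=
  weightLT_mono e n.le_succ

theorem exists_mem_weightLT (e : Module.End A W) (q : SymmetricAlgebra A W) :
    ∃ n, q ∈ weightLT e n :=
  ⟨_, mem_weightLT.2 fun _ hm => coeff_eq_zero_of_natDegree_lt (Nat.lt_of_succ_le hm)⟩

theorem eq_zero_of_mem_weightLT_zero {e : Module.End A W} {q : SymmetricAlgebra A W}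
    (hq : q ∈ weightLT e 0) : q = 0 := by
  rw [← sum_weightProj e q]
  exact Finset.sum_eq_zero fun i _ => mem_weightLT.1 hq i i.zero_le

theorem weightProj_mem_weightLT_of_lt {e : Module.End A W} (he : IsIdempotentElem e) {i n : ℕ}
    (h : i < n) (q : SymmetricAlgebra A W) : weightProj e i q ∈ weightLT e n :=
  mem_weightLT.2 fun j hj => by rw [weightProj_weightProj he, if_neg (by omega)]

theorem weightProj_mem_weightLT {e e' : Module.End A W} (h : Commute e e') (i : ℕ) {n : ℕ}
    {q : SymmetricAlgebra A W} (hq : q ∈ weightLT e n) : weightProj e' i q ∈ weightLT e n :=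
  mem_weightLT.2 fun j hj => by rw [weightProj_comm h, mem_weightLT.1 hq j hj, map_zero]

theorem ι_mul_mem_weightLT (e : Module.End A W) (y : W) {n : ℕ} {q : SymmetricAlgebra A W}
    (h : q ∈ weightLT e n) : ι A W y * q ∈ weightLT e (n + 1) :=
  mem_weightLT.2 fun j hj => by
    obtain ⟨j, rfl⟩ := Nat.exists_eq_succ_of_ne_zero (show j ≠ 0 by omega)
    rw [weightProj_succ_ι_mul]
    simp [mem_weightLT.1 h j (by omega), mem_weightLT.1 h (j + 1) (by omega)]

section FixedPoint

variable {M : Type*} [AddCommGroup M] [Module A M]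

theorem iterate_eqOn_weightLT {e : Module.End A W}
    {F : (SymmetricAlgebra A W →ₗ[A] M) → SymmetricAlgebra A W →ₗ[A] M}
    {S : Set (SymmetricAlgebra A W →ₗ[A] M)} (h0 : 0 ∈ S) (hS : Set.MapsTo F S S)
    (hF : ∀ f ∈ S, ∀ g ∈ S, ∀ n, Set.EqOn f g (weightLT e n) →
      Set.EqOn (F f) (F g) (weightLT e (n + 1)))
    {m n : ℕ} (h : n ≤ m) : Set.EqOn (F^[m] 0) (F^[n] 0) (weightLT e n) := by
  have hmem (n) : F^[n] 0 ∈ S := hS.iterate n h0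
  have succ (n) : Set.EqOn (F^[n + 1] 0) (F^[n] 0) (weightLT e n) := by
    induction n with
    | zero => intro q hq; simp [eq_zero_of_mem_weightLT_zero hq]
    | succ n ih =>
      have h := hF _ (hmem _) _ (hmem _) n ih
      rwa [← F.iterate_succ_apply', ← F.iterate_succ_apply'] at h
  induction m, h using Nat.le_induction with
  | base => exact Set.eqOn_refl _ _
  | succ m h ih => exact ((succ m).mono (weightLT_mono e h)).trans ih

theorem exists_fixedPoint {e : Module.End A W} (he : IsIdempotentElem e) (P : ℕ → Submodule A M)
    (F : (SymmetricAlgebra A W →ₗ[A] M) → SymmetricAlgebra A W →ₗ[A] M)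
    (hP : ∀ f : SymmetricAlgebra A W →ₗ[A] M, (∀ n, weightLT e n ≤ (P n).comap f) →
      ∀ n, weightLT e n ≤ (P n).comap (F f))
    (hF : ∀ f g : SymmetricAlgebra A W →ₗ[A] M, (∀ n, weightLT e n ≤ (P n).comap f) →
      (∀ n, weightLT e n ≤ (P n).comap g) → ∀ n, Set.EqOn f g (weightLT e n) →
        Set.EqOn (F f) (F g) (weightLT e (n + 1))) :
    ∃ f, (∀ n, weightLT e n ≤ (P n).comap f) ∧ F f = f := by
  let S : Set (SymmetricAlgebra A W →ₗ[A] M) := {f | ∀ n, weightLT e n ≤ (P n).comap f}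
  have h0 : (0 : SymmetricAlgebra A W →ₗ[A] M) ∈ S := fun n q _ => (P n).zero_mem
  have hmem (n) : F^[n] 0 ∈ S := Set.MapsTo.iterate (s := S) hP n h0
  have hF' (f) (hf : f ∈ S) (g) (hg : g ∈ S) := hF f g hf hg
  -- the iterates `F^[n] 0` stabilize on each step of the filtration by weight
  let limit : SymmetricAlgebra A W →ₗ[A] M := gather e fun i => F^[i + 1] 0
  have limit_eq (n) : Set.EqOn limit (F^[n] 0) (weightLT e n) := fun q hq => by
    refine induction_weight e q (by simp)
      (fun p q hp hq => by simp only [map_add, hp, hq]) fun i => ?_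
    by_cases hi : n ≤ i
    · simp [mem_weightLT.1 hq i hi]
    · rw [gather_weightProj he]
      exact (iterate_eqOn_weightLT h0 hP hF' (by omega)
        (weightProj_mem_weightLT_of_lt he i.lt_succ_self q)).symm
  have limit_mem : limit ∈ S := fun n q hq => by
    rw [Submodule.mem_comap, limit_eq n hq]
    exact hmem n n hq
  refine ⟨limit, limit_mem, LinearMap.ext fun q => ?_⟩
  obtain ⟨n, hq⟩ := exists_mem_weightLT e q
  have hq' := weightLT_le_succ e n hq
  rw [hF _ _ limit_mem (hmem n) n (limit_eq n) hq', limit_eq (n + 1) hq', F.iterate_succ_apply']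

end FixedPoint

section Rational

variable [Algebra ℚ A]

theorem algebraMap_inv_smul_nsmul {M : Type*} [AddCommGroup M] [Module A M] {n : ℕ} (hn : n ≠ 0)
    (m : M) : algebraMap ℚ A (n : ℚ)⁻¹ • n • m = m := by
  rw [← Nat.cast_smul_eq_nsmul A, smul_smul, ← map_natCast (algebraMap ℚ A), ← map_mul,
    inv_mul_cancel₀ (Nat.cast_ne_zero.2 hn), map_one, one_smul]

theorem mem_of_nsmul_mem {M : Type*} [AddCommGroup M] [Module A M] {N : Submodule A M} {n : ℕ}
    (hn : n ≠ 0) {m : M} (h : n • m ∈ N) : m ∈ N :=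
  algebraMap_inv_smul_nsmul (A := A) hn m ▸ N.smul_mem _ h

/-- Division of the component of weight `i` by `i + c`; when `c = 0`, the component of weight zero
is sent to zero. -/
def divWeight (e : Module.End A W) (c : ℕ) : SymmetricAlgebra A W →ₗ[A] SymmetricAlgebra A W :=
  gather e fun i => algebraMap ℚ A ((i + c : ℕ) : ℚ)⁻¹ • LinearMap.id

theorem divWeight_weightProj {e : Module.End A W} (he : IsIdempotentElem e) (c i : ℕ)
    (q : SymmetricAlgebra A W) :
    divWeight e c (weightProj e i q) = algebraMap ℚ A ((i + c : ℕ) : ℚ)⁻¹ • weightProj e i q :=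
  gather_weightProj he _ i q

theorem divWeight_mem_weightLT {e : Module.End A W} (he : IsIdempotentElem e) (c : ℕ) {n : ℕ}
    {q : SymmetricAlgebra A W} (hq : q ∈ weightLT e n) : divWeight e c q ∈ weightLT e n := by
  refine induction_weight (motive := fun p => divWeight e c p ∈ weightLT e n) e q (by simp)
    (fun p q hp hq => by rw [map_add]; exact add_mem hp hq) fun i => ?_
  rw [divWeight_weightProj he]
  exact Submodule.smul_mem _ _ (weightProj_mem_weightLT (.refl e) i hq)

end Rational

end Grading

section Map

variable {A V W : Type*} [CommRing A] [AddCommGroup V] [Module A V] [AddCommGroup W] [Module A W]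

/-- The algebra morphism `S(V) → S(W)` induced by a linear map `V → W`. -/
def mapHom (f : V →ₗ[A] W) : SymmetricAlgebra A V →ₐ[A] SymmetricAlgebra A W :=
  SymmetricAlgebra.lift (ι A W ∘ₗ f)

@[simp]
theorem mapHom_ι (f : V →ₗ[A] W) (v : V) : mapHom f (ι A V v) = ι A W (f v) :=
  lift_ι_apply _ _

theorem mapHom_comp {X : Type*} [AddCommGroup X] [Module A X] (g : W →ₗ[A] X) (f : V →ₗ[A] W) :
    (mapHom g).comp (mapHom f) = mapHom (g ∘ₗ f) := by
  apply SymmetricAlgebra.algHom_ext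
  ext y
  simp

theorem mapHom_id : mapHom (LinearMap.id : V →ₗ[A] V) = AlgHom.id A _ := by
  apply SymmetricAlgebra.algHom_ext
  ext y
  simp

theorem mapHom_mapHom {X : Type*} [AddCommGroup X] [Module A X] (g : W →ₗ[A] X) (f : V →ₗ[A] W)
    (q : SymmetricAlgebra A V) : mapHom g (mapHom f q) = mapHom (g ∘ₗ f) q :=
  DFunLike.congr_fun (mapHom_comp g f) q

theorem weightProj_zero_eq_mapHom (e : Module.End A W) (q : SymmetricAlgebra A W) :
    weightProj e 0 q = mapHom (1 - e) q := by
  induction q using induction_ι_mul with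
  | one => simp [weightProj_zero_one]
  | smul a q hq => simp only [map_smul, hq]
  | add p q hp hq => simp only [map_add, hp, hq]
  | mul y q hq => simp [weightProj_zero_ι_mul, hq]

theorem weightProj_one_zero (q : SymmetricAlgebra A W) :
    weightProj 1 0 q = algebraMap A _ (SymmetricAlgebra.algebraMapInv q) := by
  induction q using induction_ι_mul with
  | one => simp [weightProj_zero_one]
  | smul a q hq => rw [map_smul, hq, map_smul, smul_eq_mul, map_mul, Algebra.smul_def]
  | add p q hp hq => simp only [map_add, hp, hq]
  | mul y q _ => simp [weightProj_zero_ι_mul, SymmetricAlgebra.algebraMapInv_ι]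

instance [Module.Projective A W] : Module.Projective A (SymmetricAlgebra A W) := by
  obtain ⟨s, hs⟩ := Module.projective_def'.1 ‹Module.Projective A W›
  refine Module.Projective.of_split (mapHom s).toLinearMap
    (mapHom (Finsupp.linearCombination A id)).toLinearMap ?_
  rw [← AlgHom.comp_toLinearMap, mapHom_comp, hs, mapHom_id]
  rfl

end Map

section Derivation

variable {A W : Type*} [CommRing A] [AddCommGroup W] [Module A W]

/-- The algebra morphism `q ↦ (q, diff e q)` from `S(W)` to the square zero extension of `S(W)` by
`S(W) ⊗ W`. -/
def diffHom (e : Module.End A W) : SymmetricAlgebra A W →ₐ[A]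
    TrivSqZeroExt (SymmetricAlgebra A W) (SymmetricAlgebra A W ⊗[A] W) :=
  SymmetricAlgebra.lift
    ((TrivSqZeroExt.inlAlgHom A _ (SymmetricAlgebra A W ⊗[A] W)).toLinearMap ∘ₗ ι A W +
      (TrivSqZeroExt.inrHom (SymmetricAlgebra A W) (SymmetricAlgebra A W ⊗[A] W)).restrictScalars A
        ∘ₗ TensorProduct.mk A (SymmetricAlgebra A W) W 1 ∘ₗ e)

theorem diffHom_ι (e : Module.End A W) (y : W) :
    diffHom e (ι A W y) = TrivSqZeroExt.inl (ι A W y) + TrivSqZeroExt.inr (1 ⊗ₜ e y) :=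
  lift_ι_apply _ _

theorem fst_diffHom (e : Module.End A W) (q : SymmetricAlgebra A W) : (diffHom e q).fst = q := by
  have h : (TrivSqZeroExt.fstHom A (SymmetricAlgebra A W) (SymmetricAlgebra A W ⊗[A] W)).comp
      (diffHom e) = AlgHom.id A _ := by
    apply SymmetricAlgebra.algHom_ext
    ext y
    simp [diffHom_ι]
  exact DFunLike.congr_fun h q

/-- The derivation `S(W) → S(W) ⊗ W` that maps `y : W` to `1 ⊗ e y`. -/
def diff (e : Module.End A W) :
    Derivation A (SymmetricAlgebra A W) (SymmetricAlgebra A W ⊗[A] W) :=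
  .mk' ((TrivSqZeroExt.sndHom (SymmetricAlgebra A W)
      (SymmetricAlgebra A W ⊗[A] W)).restrictScalars A ∘ₗ (diffHom e).toLinearMap) fun p q => by
    simp [TrivSqZeroExt.snd_mul, fst_diffHom]

theorem diff_ι (e : Module.End A W) (y : W) : diff e (ι A W y) = 1 ⊗ₜ e y := by
  simp [diff, diffHom_ι]

theorem diff_ι_mul (e : Module.End A W) (y : W) (q : SymmetricAlgebra A W) :
    diff e (ι A W y * q) = q ⊗ₜ e y + ι A W y • diff e q := by
  rw [Derivation.leibniz, diff_ι, add_comm, TensorProduct.smul_tmul', smul_eq_mul, mul_one]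

theorem rTensor_weightProj_zero_ι_smul (e : Module.End A W) (y : W)
    (s : SymmetricAlgebra A W ⊗[A] W) :
    (weightProj e 0).rTensor W (ι A W y • s) =
      ι A W (y - e y) • (weightProj e 0).rTensor W s := by
  induction s with
  | zero => simp
  | add s t hs ht => simp only [smul_add, map_add, hs, ht]
  | tmul p w =>
    simp only [TensorProduct.smul_tmul', smul_eq_mul, LinearMap.rTensor_tmul, weightProj_zero_ι_mul]

theorem rTensor_weightProj_succ_ι_smul (e : Module.End A W) (i : ℕ) (y : W)
    (s : SymmetricAlgebra A W ⊗[A] W) :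
    (weightProj e (i + 1)).rTensor W (ι A W y • s) =
      ι A W (y - e y) • (weightProj e (i + 1)).rTensor W s +
        ι A W (e y) • (weightProj e i).rTensor W s := by
  induction s with
  | zero => simp
  | add s t hs ht => simp only [smul_add, map_add, hs, ht, add_add_add_comm]
  | tmul p w =>
    simp only [TensorProduct.smul_tmul', smul_eq_mul, LinearMap.rTensor_tmul,
      weightProj_succ_ι_mul, TensorProduct.add_tmul]

theorem diff_weightProj_zero {e e' : Module.End A W} (h : e * e' = e) (q : SymmetricAlgebra A W) :
    diff e (weightProj e' 0 q) = 0 := by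
  have h (y) : e (e' y) = e y := LinearMap.congr_fun h y
  induction q using induction_ι_mul with
  | one => simp [weightProj_zero_one]
  | smul a q hq => simp only [map_smul, Derivation.map_smul, hq, smul_zero]
  | add p q hp hq => simp only [map_add, hp, hq, add_zero]
  | mul y q hq => rw [weightProj_zero_ι_mul, diff_ι_mul, hq, map_sub, h]; simp

theorem diff_weightProj_succ {e e' : Module.End A W} (h : e * e' = e) (i : ℕ)
    (q : SymmetricAlgebra A W) :
    diff e (weightProj e' (i + 1) q) = (weightProj e' i).rTensor W (diff e q) := by
  have h' (y) : e (e' y) = e y := LinearMap.congr_fun h y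
  induction q using induction_ι_mul generalizing i with
  | one => simp [weightProj_succ_one]
  | smul a q hq => simp only [map_smul, Derivation.map_smul, hq]
  | add p q hp hq => simp only [map_add, hp, hq]
  | mul y q hq =>
    rw [weightProj_succ_ι_mul, map_add, diff_ι_mul, diff_ι_mul, hq, diff_ι_mul, map_add,
      LinearMap.rTensor_tmul, map_sub, h', sub_self, TensorProduct.tmul_zero, zero_add,
      add_left_comm]
    congr 1
    cases i with
    | zero => rw [diff_weightProj_zero h, smul_zero, add_zero, rTensor_weightProj_zero_ι_smul]
    | succ i => rw [hq, rTensor_weightProj_succ_ι_smul]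

/-- The contraction `p ⊗ w ↦ (e w) p`. -/
def contract (e : Module.End A W) :
    SymmetricAlgebra A W ⊗[A] W →ₗ[SymmetricAlgebra A W] SymmetricAlgebra A W :=
  (ι A W ∘ₗ e).liftBaseChange (SymmetricAlgebra A W)

theorem contract_tmul (e : Module.End A W) (p : SymmetricAlgebra A W) (w : W) :
    contract e (p ⊗ₜ w) = ι A W (e w) * p := by
  simp [contract, mul_comm]

theorem contract_diff_weightProj {e : Module.End A W} (he : IsIdempotentElem e) (i : ℕ)
    (q : SymmetricAlgebra A W) :
    contract e (diff e (weightProj e i q)) = i • weightProj e i q := by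
  have he' (y) : e (e y) = e y := LinearMap.congr_fun he y
  induction q using induction_ι_mul generalizing i with
  | one => cases i <;> simp [weightProj_zero_one, weightProj_succ_one]
  | smul a q hq => rw [map_smul, Derivation.map_smul, LinearMap.map_smul_of_tower, hq, smul_comm]
  | add p q hp hq => simp only [map_add, hp, hq, smul_add]
  | mul y q hq =>
    cases i with
    | zero => simp [diff_weightProj_zero he]
    | succ i =>
      rw [weightProj_succ_ι_mul, map_add, map_add, diff_ι_mul, diff_ι_mul, map_add, map_add,
        map_smul, map_smul, hq, hq, contract_tmul, contract_tmul, map_sub e, he', sub_self, he',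
        map_zero, map_zero, zero_mul]
      simp only [smul_eq_mul, nsmul_eq_mul, Nat.cast_add, Nat.cast_one]
      ring

theorem diff_induction {e e' : Module.End A W} (h : e * e' = e) (he' : IsIdempotentElem e') {n : ℕ}
    {q : SymmetricAlgebra A W} (hq : q ∈ weightLT e' (n + 1))
    {motive : SymmetricAlgebra A W ⊗[A] W → Prop}
    (zero : motive 0) (add : ∀ s t, motive s → motive t → motive (s + t))
    (tmul : ∀ p w, p ∈ weightLT e' n → motive (p ⊗ₜ w)) : motive (diff e q) := by
  refine induction_weight e' q (motive := fun q => motive (diff e q)) (by simpa using zero)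
    (fun p q hp hq => by rw [map_add]; exact add _ _ hp hq) fun i => ?_
  rcases i with - | i
  · rwa [diff_weightProj_zero h]
  by_cases hi : n ≤ i
  · rwa [mem_weightLT.1 hq (i + 1) (by omega), map_zero]
  rw [diff_weightProj_succ h]
  induction diff e q with
  | zero => simpa using zero
  | tmul p w => exact tmul _ _ (weightProj_mem_weightLT_of_lt he' (by omega) _)
  | add s t hs ht => rw [map_add]; exact add _ _ hs ht

end Derivation

section Connection

variable {A L W M N : Type*} [CommRing A] [LieRing L] [Module A L] [LieRingModule L A]
  [AddCommGroup W] [Module A W] [AddCommGroup M] [Module A M] [AddCommGroup N] [Module A N]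

/-- A family `D` of additive operators on `M`, depending linearly on `w : W`, satisfies the Leibniz
rule with respect to the derivations of `A` that the anchor associates with `t w`. For `t = id`
this is a connection on `M` along the Lie–Rinehart algebra `L`. -/
def IsConnection (t : W →ₗ[A] L) (D : W →ₗ[A] (M →+ M)) : Prop :=
  ∀ (w : W) (a : A) (m : M), D w (a • m) = a • D w m + ⁅t w, a⁆ • m

theorem IsConnection.comp {X : Type*} [AddCommGroup X] [Module A X] {t : W →ₗ[A] L}
    {D : W →ₗ[A] (M →+ M)} (h : IsConnection t D) (f : X →ₗ[A] W) :
    IsConnection (t ∘ₗ f) (D ∘ₗ f) :=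
  fun w a m => h (f w) a m

/-- The family of operators `r ∘ D w ∘ i` on `M`. -/
def compress (i : M →ₗ[A] N) (r : N →ₗ[A] M) (D : W →ₗ[A] (N →+ N)) : W →ₗ[A] (M →+ M) where
  toFun w := r.toAddMonoidHom.comp ((D w).comp i.toAddMonoidHom)
  map_add' v w := by ext m; simp
  map_smul' a w := by ext m; simp

theorem IsConnection.compress {i : M →ₗ[A] N} {r : N →ₗ[A] M} (h : r ∘ₗ i = LinearMap.id)
    {t : W →ₗ[A] L} {D : W →ₗ[A] (N →+ N)} (hD : IsConnection t D) :
    IsConnection t (compress i r D) := fun w a m => by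
  have h : r (i m) = m := LinearMap.congr_fun h m
  simp [LieRinehartPBW.compress, hD w, h]

variable [LieRinehartRing A L]

variable (A L) in
/-- The connection on the free module on `I` that applies the anchor to each coordinate. -/
def finsuppConnection (I : Type*) : L →ₗ[A] ((I →₀ A) →+ (I →₀ A)) where
  toFun x := Finsupp.mapRange.addMonoidHom (AddMonoidHom.mk' (⁅x, ·⁆) (lie_add x))
  map_add' x y := AddMonoidHom.ext fun f => Finsupp.ext fun i => add_lie x y (f i)
  map_smul' a x := AddMonoidHom.ext fun f => Finsupp.ext fun i =>
    LieRinehartRing.lie_smul_eq_mul a (f i) x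

theorem isConnection_finsuppConnection (I : Type*) :
    IsConnection LinearMap.id (finsuppConnection A L I) := fun x a f =>
  Finsupp.ext fun i => by
    simp [finsuppConnection, LieRinehartRing.leibniz_mul_right]

variable (A L M) in
theorem exists_isConnection [Module.Projective A M] :
    ∃ D : L →ₗ[A] (M →+ M), IsConnection LinearMap.id D := by
  obtain ⟨s, hs⟩ := Module.projective_def'.1 ‹Module.Projective A M›
  exact ⟨_, (isConnection_finsuppConnection M).compress hs⟩

end Connection

section Average

variable {A L V W : Type*} [CommRing A] [LieRing L] [Module A L] [AddCommGroup V] [Module A V]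
  [AddCommGroup W] [Module A W]

/-- The part of a family of operators on `S(W)` that preserves the weights for `e`. -/
def average (e : Module.End A W) (D : V →ₗ[A] (SymmetricAlgebra A W →+ SymmetricAlgebra A W)) :
    V →ₗ[A] (SymmetricAlgebra A W →+ SymmetricAlgebra A W) where
  toFun x := (gather e fun i =>
    ((weightProj e i).toAddMonoidHom.comp (D x)).toIntLinearMap).toAddMonoidHom
  map_add' x y := AddMonoidHom.ext fun q => by
    simp [gather, Polynomial.sum_def, Finset.sum_add_distrib]
  map_smul' a x := AddMonoidHom.ext fun q => by
    simp [gather, Polynomial.sum_def, Finset.smul_sum]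

variable {e : Module.End A W} {D : V →ₗ[A] (SymmetricAlgebra A W →+ SymmetricAlgebra A W)}

theorem average_weightProj (he : IsIdempotentElem e) (x : V) (i : ℕ) (q : SymmetricAlgebra A W) :
    average e D x (weightProj e i q) = weightProj e i (D x (weightProj e i q)) :=
  gather_weightProj he _ i q

theorem average_weightProj_comm (he : IsIdempotentElem e) (x : V) (i : ℕ)
    (q : SymmetricAlgebra A W) :
    average e D x (weightProj e i q) = weightProj e i (average e D x q) := by
  refine induction_weight e q (by simp) (fun p q hp hq => by simp only [map_add, hp, hq])
    fun j => ?_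
  rw [average_weightProj he x j, weightProj_weightProj he, weightProj_weightProj he]
  split_ifs with h
  · rw [average_weightProj he]
  · exact map_zero _

theorem IsConnection.average [LieRingModule L A] (he : IsIdempotentElem e) {t : V →ₗ[A] L}
    (h : IsConnection t D) : IsConnection t (average e D) := fun x a q => by
  refine induction_weight e q (by simp)
    (fun p q hp hq => by simp only [smul_add, map_add, hp, hq]; abel) fun i => ?_
  rw [← map_smul, average_weightProj he, average_weightProj he, map_smul, h x, map_add, map_smul,
    map_smul, weightProj_self he]

theorem average_mem_weightLT {e' : Module.End A W} (he : IsIdempotentElem e) (hee' : Commute e' e)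
    {n : ℕ} (h : ∀ x, ∀ q ∈ weightLT e' n, D x q ∈ weightLT e' n) (x : V)
    {q : SymmetricAlgebra A W} (hq : q ∈ weightLT e' n) : average e D x q ∈ weightLT e' n := by
  refine induction_weight (motive := fun q => LieRinehartPBW.average e D x q ∈ weightLT e' n) e q
    (by simp) (fun p q hp hq => by rw [map_add]; exact add_mem hp hq) fun i => ?_
  rw [average_weightProj he]
  exact weightProj_mem_weightLT hee' i (h x _ (weightProj_mem_weightLT hee' i hq))

variable [LieRingModule L A]

/-- A connection on `S(W)` whose operators preserve the weights for `e` and do not raise degrees. -/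
structure IsGradedConnection (t : V →ₗ[A] L) (e : Module.End A W)
    (D : V →ₗ[A] (SymmetricAlgebra A W →+ SymmetricAlgebra A W)) : Prop where
  isConnection : IsConnection t D
  weightProj_comm (x : V) (i : ℕ) (q : SymmetricAlgebra A W) :
    D x (weightProj e i q) = weightProj e i (D x q)
  mem_degreeLT (n : ℕ) (x : V) : ∀ q ∈ degreeLT A W n, D x q ∈ degreeLT A W n

theorem IsGradedConnection.comp {U : Type*} [AddCommGroup U] [Module A U] {t : V →ₗ[A] L}
    (h : IsGradedConnection t e D) (f : U →ₗ[A] V) :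
    IsGradedConnection (t ∘ₗ f) e (D ∘ₗ f) where
  isConnection := h.isConnection.comp f
  weightProj_comm x := h.weightProj_comm (f x)
  mem_degreeLT n x := h.mem_degreeLT n (f x)

variable (L) in
theorem exists_isGradedConnection [LieRinehartRing A L] [Module.Projective A W]
    (he : IsIdempotentElem e) :
    ∃ D : L →ₗ[A] (SymmetricAlgebra A W →+ SymmetricAlgebra A W),
      IsGradedConnection LinearMap.id e D := by
  obtain ⟨D, hD⟩ := exists_isConnection A L (SymmetricAlgebra A W)
  refine ⟨average e (average 1 D), (hD.average .one).average he,
    average_weightProj_comm he, fun n x q hq =>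
      average_mem_weightLT he (.one_left e) (fun x p hp => mem_weightLT.2 fun m hm => ?_) x hq⟩
  rw [← average_weightProj_comm .one, mem_weightLT.1 hp m hm, map_zero]

end Average

section Unipotent

variable {A W : Type*} [CommRing A] [AddCommGroup W] [Module A W]

theorem bijective_of_sub_mem_degreeLT {g : SymmetricAlgebra A W →ₗ[A] SymmetricAlgebra A W}
    (hg : ∀ n, ∀ q ∈ degreeLT A W (n + 1), g q - q ∈ degreeLT A W n) : Function.Bijective g := by
  refine ⟨(injective_iff_map_eq_zero g).2 fun q hq => ?_, fun q => ?_⟩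
  · obtain ⟨n, hn⟩ := exists_mem_weightLT 1 q
    induction n with
    | zero => exact eq_zero_of_mem_weightLT_zero hn
    | succ n ih => exact ih (by simpa [hq] using hg n q hn)
  · obtain ⟨n, hn⟩ := exists_mem_weightLT 1 q
    induction n generalizing q with
    | zero => exact ⟨0, by rw [eq_zero_of_mem_weightLT_zero hn, map_zero]⟩
    | succ n ih =>
      obtain ⟨p, hp⟩ := ih (g q - q) (hg n q hn)
      exact ⟨q - p, by rw [map_sub, hp, sub_sub_cancel]⟩

end Unipotent

section Symmetrization

variable {A L W M : Type*} [CommRing A] [LieRing L] [Module A L] [LieRingModule L A]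
  [AddCommGroup W] [Module A W] [AddCommGroup M] [Module A M]
  {t : W →ₗ[A] L} {e : Module.End A W}
  {D : W →ₗ[A] (SymmetricAlgebra A W →+ SymmetricAlgebra A W)} {T : W →ₗ[A] (M →+ M)}

/-- The map `p ⊗ w ↦ T w (φ p) - φ (D w p)`, which is linear because the derivation terms of
the two connections cancel. -/
def covariantDiff (hD : IsConnection t D) (hT : IsConnection t T)
    (φ : SymmetricAlgebra A W →ₗ[A] M) : SymmetricAlgebra A W ⊗[A] W →ₗ[A] M :=
  TensorProduct.lift (LinearMap.mk₂ A (fun p w => T w (φ p) - φ (D w p))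
    (fun p q w => by simp only [map_add]; abel)
    (fun a p w => by simp only [map_smul, hD w, hT w, map_add, smul_sub]; abel)
    (fun p v w => by simp only [map_add, AddMonoidHom.add_apply]; abel)
    (fun a p w => by simp only [map_smul, AddMonoidHom.smul_apply, smul_sub]))

theorem covariantDiff_tmul (hD : IsConnection t D) (hT : IsConnection t T)
    (φ : SymmetricAlgebra A W →ₗ[A] M) (p : SymmetricAlgebra A W) (w : W) :
    covariantDiff hD hT φ (p ⊗ₜ w) = T w (φ p) - φ (D w p) := by
  simp [covariantDiff]

/-- A symmetrization map `φ` sends a product of `i` elements of the image of `e` to the average,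
over its factors `w`, of the values of `T w ∘ φ - φ ∘ D w` at the product of the other factors. For
`M = U(L)`, a Lie algebra `L` over a field and `D = 0`, this is the usual symmetrization map
`S(L) → U(L)`. -/
def IsSymmetrization (hD : IsConnection t D) (hT : IsConnection t T) (e : Module.End A W)
    (φ : SymmetricAlgebra A W →ₗ[A] M) : Prop :=
  ∀ i q, covariantDiff hD hT φ (diff e (weightProj e i q)) = i • φ (weightProj e i q)

theorem IsGradedConnection.mem_weightLT (hD : IsGradedConnection t e D) {n : ℕ} (w : W)
    {q : SymmetricAlgebra A W} (hq : q ∈ weightLT e n) : D w q ∈ weightLT e n :=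
  LieRinehartPBW.mem_weightLT.2 fun m hm => by
    rw [← hD.weightProj_comm, LieRinehartPBW.mem_weightLT.1 hq m hm, map_zero]

theorem exists_isSymmetrization [Algebra ℚ A] (he : IsIdempotentElem e)
    (hD : IsGradedConnection t e D) (hT : IsConnection t T) (f : SymmetricAlgebra A W →ₗ[A] M) :
    ∃ φ, IsSymmetrization hD.isConnection hT e φ ∧
      ∀ q, φ (weightProj e 0 q) = f (weightProj e 0 q) := by
  let F (φ : SymmetricAlgebra A W →ₗ[A] M) : SymmetricAlgebra A W →ₗ[A] M :=
    f ∘ₗ weightProj e 0 +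
      covariantDiff hD.isConnection hT φ ∘ₗ (diff e : _ →ₗ[A] _) ∘ₗ divWeight e 0
  have F_apply (φ q) : F φ q = f (weightProj e 0 q) +
    covariantDiff hD.isConnection hT φ (diff e (divWeight e 0 q)) := rfl
  obtain ⟨φ, -, hφ⟩ := exists_fixedPoint he ⊤ F (by simp) fun φ ψ _ _ n h q hq => by
    rw [F_apply, F_apply]
    congr 1
    refine diff_induction (motive := fun s => covariantDiff hD.isConnection hT φ s =
      covariantDiff hD.isConnection hT ψ s) he he (divWeight_mem_weightLT he 0 hq) (by simp)
      (fun s t hs ht => by rw [map_add, map_add, hs, ht]) fun p w hp => ?_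
    rw [covariantDiff_tmul, covariantDiff_tmul, h hp, h (hD.mem_weightLT w hp)]
  have proj_zero (q) : φ (weightProj e 0 q) = f (weightProj e 0 q) := by
    rw [← hφ, F_apply, weightProj_self he, divWeight_weightProj he, Derivation.map_smul,
      diff_weightProj_zero he, smul_zero, map_zero, add_zero]
  refine ⟨φ, fun i q => ?_, proj_zero⟩
  rcases i with - | i
  · rw [diff_weightProj_zero he, map_zero, zero_smul]
  · conv_rhs => rw [← hφ]
    rw [F_apply, weightProj_weightProj he, if_neg (by omega), map_zero, zero_add,
      divWeight_weightProj he, Derivation.map_smul, map_smul, smul_comm, add_zero,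
      algebraMap_inv_smul_nsmul i.succ_ne_zero]

/-- The operators `T w` on `M` obey the Leibniz rule with respect to the derivations of `A` given by
`t w`, depend on `e w` only and are closed under commutators. -/
structure IsActionAlong (t : W →ₗ[A] L) (e : Module.End A W) (T : W →ₗ[A] (M →+ M)) : Prop where
  isConnection : IsConnection t T
  apply_idempotent (w : W) : T (e w) = T w
  exists_commutator (v w : W) : ∃ z, ∀ m, T v (T w m) = T w (T v m) + T z m

namespace IsSymmetrization

variable {φ : SymmetricAlgebra A W →ₗ[A] M}

theorem apply_mem_map {n : ℕ}
    (h : ∀ w, ∀ q ∈ degreeLT A W n, T w (φ q) - φ (ι A W (e w) * q) ∈ (degreeLT A W n).map φ)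
    (w : W) : ∀ m ∈ (degreeLT A W n).map φ, T w m ∈ (degreeLT A W (n + 1)).map φ := by
  rintro _ ⟨q, hq, rfl⟩
  simpa only [sub_add_cancel] using add_mem
    (Submodule.map_mono (f := φ) (weightLT_le_succ 1 n) (h w q hq))
    (Submodule.mem_map_of_mem (ι_mul_mem_weightLT 1 (e w) hq))

theorem covariantDiff_ι_mul_sub_mem (hD : IsGradedConnection t e D) (hT : IsActionAlong t e T)
    {n : ℕ}
    (h : ∀ w, ∀ q ∈ degreeLT A W n, T w (φ q) - φ (ι A W (e w) * q) ∈ (degreeLT A W n).map φ)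
    (v w : W) {p : SymmetricAlgebra A W} (hp : p ∈ degreeLT A W n) :
    covariantDiff hD.isConnection hT.isConnection φ ((ι A W (e w) * p) ⊗ₜ v) -
      T w (covariantDiff hD.isConnection hT.isConnection φ (p ⊗ₜ v)) ∈
        (degreeLT A W (n + 1)).map φ := by
  have hφ {q} (hq : q ∈ degreeLT A W n) := Submodule.mem_map_of_mem (f := φ) hq
  obtain ⟨z, hz⟩ := hT.exists_commutator v w
  have split : covariantDiff hD.isConnection hT.isConnection φ ((ι A W (e w) * p) ⊗ₜ v) -
      T w (covariantDiff hD.isConnection hT.isConnection φ (p ⊗ₜ v)) =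
      T z (φ p) - T v (T w (φ p) - φ (ι A W (e w) * p)) - φ (D v (ι A W (e w) * p)) +
        T w (φ (D v p)) := by
    rw [covariantDiff_tmul, covariantDiff_tmul, map_sub, map_sub, hz]
    abel
  rw [split]
  exact add_mem (sub_mem (sub_mem (apply_mem_map h z _ (hφ hp)) (apply_mem_map h v _ (h w p hp)))
    (Submodule.mem_map_of_mem (hD.mem_degreeLT _ v _ (ι_mul_mem_weightLT 1 _ hp))))
    (apply_mem_map h w _ (hφ (hD.mem_degreeLT n v p hp)))

variable [Algebra ℚ A] (he : IsIdempotentElem e)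

include he

theorem apply_sub_mem (hD : IsGradedConnection t e D) (hT : IsActionAlong t e T)
    (hφ : IsSymmetrization hD.isConnection hT.isConnection e φ) (n : ℕ) (w : W) :
    ∀ q ∈ degreeLT A W n, T w (φ q) - φ (ι A W (e w) * q) ∈ (degreeLT A W n).map φ := by
  have he' (y) : e (e y) = e y := LinearMap.congr_fun he y
  induction n generalizing w with
  | zero => intro q hq; simp [eq_zero_of_mem_weightLT_zero hq]
  | succ n ih =>
    intro q hq
    refine induction_weight (motive := fun q => T w (φ q) - φ (ι A W (e w) * q) ∈
      (degreeLT A W (n + 1)).map φ) e q (by simp) (fun p q hp hq => ?_) fun i => ?_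
    · rw [map_add, map_add, mul_add, map_add, add_sub_add_comm]
      exact add_mem hp hq
    set p := weightProj e i q with p_def
    have hp : p ∈ degreeLT A W (n + 1) := weightProj_mem_weightLT (.one_left e) i hq
    have mul_diff : covariantDiff hD.isConnection hT.isConnection φ (ι A W (e w) • diff e p) -
        i • T w (φ p) ∈ (degreeLT A W (n + 1)).map φ := by
      rw [← map_nsmul, ← hφ]
      refine diff_induction (motive := fun s => covariantDiff hD.isConnection hT.isConnection φ
        (ι A W (e w) • s) - T w (covariantDiff hD.isConnection hT.isConnection φ s) ∈ _)
        (mul_one e) .one hp (by simp) (fun s t hs ht => ?_) fun p v hp => ?_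
      · simp only [smul_add, map_add, add_sub_add_comm]
        exact add_mem hs ht
      · exact covariantDiff_ι_mul_sub_mem hD hT ih v w hp
    have weight_succ : weightProj e (i + 1) (ι A W (e w) * p) = ι A W (e w) * p := by
      rw [weightProj_succ_ι_mul, he', sub_self, map_zero, zero_mul, zero_add, p_def,
        weightProj_self he]
    have symm := hφ (i + 1) (ι A W (e w) * p)
    rw [weight_succ, diff_ι_mul, map_add, covariantDiff_tmul, he', hT.apply_idempotent] at symm
    have hDp := Submodule.mem_map_of_mem (f := φ) (hD.mem_degreeLT (n + 1) (e w) p hp)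
    refine mem_of_nsmul_mem (A := A) i.succ_ne_zero ?_
    convert sub_mem hDp mul_diff using 1
    rw [Nat.succ_eq_add_one, smul_sub, ← symm, add_smul, one_smul]
    abel

theorem apply_mem_range (hD : IsGradedConnection t e D) (hT : IsActionAlong t e T)
    (hφ : IsSymmetrization hD.isConnection hT.isConnection e φ) (w : W) :
    ∀ m ∈ LinearMap.range φ, T w m ∈ LinearMap.range φ := by
  rintro _ ⟨q, rfl⟩
  obtain ⟨n, hn⟩ := exists_mem_weightLT 1 q
  simpa only [sub_add_cancel] using add_mem
    (LinearMap.map_le_range (hφ.apply_sub_mem he hD hT n w q hn))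
    (LinearMap.mem_range_self φ (ι A W (e w) * q))

end IsSymmetrization

/-- The operators `E w` raise degrees by at most one, and their symbols are the multiplications by
`w`. -/
def HasMulSymbol (E : W →ₗ[A] (SymmetricAlgebra A W →+ SymmetricAlgebra A W)) : Prop :=
  ∀ n w, ∀ q ∈ degreeLT A W n, E w q - ι A W w * q ∈ degreeLT A W n

namespace IsSymmetrization

variable [Algebra ℚ A] {φ : SymmetricAlgebra A W →ₗ[A] M} {Ψ : M →ₗ[A] SymmetricAlgebra A W}

theorem apply_sub_mem_of_covariantDiff (he : IsIdempotentElem e) (hD : IsConnection t D)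
    (hT : IsConnection t T) (hφ : IsSymmetrization hD hT e φ)
    (h0 : ∀ q, Ψ (φ (weightProj e 0 q)) = weightProj e 0 q) {n : ℕ}
    (h : ∀ p ∈ degreeLT A W n, ∀ v,
      Ψ (covariantDiff hD hT φ (p ⊗ₜ v)) - contract e (p ⊗ₜ v) ∈ degreeLT A W n) :
    ∀ q ∈ degreeLT A W (n + 1), Ψ (φ q) - q ∈ degreeLT A W n := fun q hq => by
  refine induction_weight (motive := fun q => Ψ (φ q) - q ∈ degreeLT A W n) e q (by simp)
    (fun p q hp hq => ?_) fun i => ?_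
  · rw [map_add, map_add, add_sub_add_comm]
    exact add_mem hp hq
  rcases Nat.eq_zero_or_pos i with rfl | hi
  · rw [h0, sub_self]
    exact zero_mem _
  have hdiff : Ψ (covariantDiff hD hT φ (diff e (weightProj e i q))) -
      contract e (diff e (weightProj e i q)) ∈ degreeLT A W n := by
    refine diff_induction (motive := fun s => Ψ (covariantDiff hD hT φ s) - contract e s ∈ _)
      (mul_one e) .one (weightProj_mem_weightLT (.one_left e) i hq) (by simp)
      (fun s t hs ht => ?_) fun p v hp => h p hp v
    simp only [map_add, add_sub_add_comm]
    exact add_mem hs ht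
  rw [hφ, contract_diff_weightProj he, map_nsmul, ← smul_sub] at hdiff
  exact mem_of_nsmul_mem hi.ne' hdiff

theorem intertwiner_sub_mem (he : IsIdempotentElem e) (hD : IsGradedConnection t e D)
    (hT : IsConnection t T) (hφ : IsSymmetrization hD.isConnection hT e φ)
    {E : W →ₗ[A] (SymmetricAlgebra A W →+ SymmetricAlgebra A W)} (hE : HasMulSymbol E)
    (hΨ : ∀ w m, Ψ (T w m) = E (e w) (Ψ m))
    (h0 : ∀ q, Ψ (φ (weightProj e 0 q)) = weightProj e 0 q) (n : ℕ) :
    ∀ q ∈ degreeLT A W (n + 1), Ψ (φ q) - q ∈ degreeLT A W n := by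
  induction n with
  | zero =>
    refine hφ.apply_sub_mem_of_covariantDiff he hD.isConnection hT h0 fun p hp v => ?_
    simp [eq_zero_of_mem_weightLT_zero hp]
  | succ n ih =>
    refine hφ.apply_sub_mem_of_covariantDiff he hD.isConnection hT h0 fun p hp v => ?_
    have mem_degreeLT (q) (hq : q ∈ degreeLT A W (n + 1)) : Ψ (φ q) ∈ degreeLT A W (n + 1) := by
      simpa only [sub_add_cancel] using add_mem (weightLT_le_succ 1 n (ih q hq)) hq
    have split : Ψ (covariantDiff hD.isConnection hT φ (p ⊗ₜ v)) - contract e (p ⊗ₜ v) =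
        E (e v) (Ψ (φ p)) - ι A W (e v) * Ψ (φ p) + ι A W (e v) * (Ψ (φ p) - p) -
          Ψ (φ (D v p)) := by
      rw [covariantDiff_tmul, contract_tmul, map_sub, hΨ]
      ring
    rw [split]
    exact sub_mem (add_mem (hE _ _ _ (mem_degreeLT p hp)) (ι_mul_mem_weightLT 1 _ (ih p hp)))
      (mem_degreeLT _ (hD.mem_degreeLT _ v p hp))

end IsSymmetrization

theorem bijective_of_intertwiner [LieRinehartRing A L] [Algebra ℚ A] [Module.Projective A W]
    (he : IsIdempotentElem e) (hT : IsActionAlong t e T)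
    {E : W →ₗ[A] (SymmetricAlgebra A W →+ SymmetricAlgebra A W)} (hE : HasMulSymbol E)
    {Ψ : M →ₗ[A] SymmetricAlgebra A W} (hΨ : ∀ w m, Ψ (T w m) = E (e w) (Ψ m))
    {f : SymmetricAlgebra A W →ₗ[A] M}
    (hf : ∀ q, Ψ (f (weightProj e 0 q)) = weightProj e 0 q)
    (hgen : ∀ N : Submodule A M, (∀ q, f (weightProj e 0 q) ∈ N) →
      (∀ w, ∀ m ∈ N, T w m ∈ N) → N = ⊤) :
    Function.Bijective Ψ := by
  obtain ⟨D, hD⟩ := exists_isGradedConnection L he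
  obtain ⟨φ, hφ, φ_zero⟩ := exists_isSymmetrization he (hD.comp t) hT.isConnection f
  have comp_bijective : Function.Bijective (Ψ ∘ₗ φ) := bijective_of_sub_mem_degreeLT <|
    hφ.intertwiner_sub_mem he (hD.comp t) hT.isConnection hE hΨ fun q => by rw [φ_zero, hf]
  have φ_surjective : Function.Surjective φ := LinearMap.range_eq_top.1 <|
    hgen _ (fun q => ⟨_, φ_zero q⟩) (hφ.apply_mem_range he (hD.comp t) hT)
  exact ⟨.of_comp_right comp_bijective.1 φ_surjective, .of_comp comp_bijective.2⟩

end Symmetrization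

section FlatConnection

variable {A L M : Type*} [CommRing A] [LieRing L] [Module A L] [AddCommGroup M] [Module A M]

/-- The curvature of the family of operators `E` vanishes at `m`. -/
def IsFlatAt (E : L →ₗ[A] (M →+ M)) (m : M) : Prop :=
  ∀ x y, E ⁅x, y⁆ m = E x (E y m) - E y (E x m)

theorem IsFlatAt.add {E : L →ₗ[A] (M →+ M)} {m n : M} (hm : IsFlatAt E m) (hn : IsFlatAt E n) :
    IsFlatAt E (m + n) := fun x y => by
  simp only [map_add, hm x y, hn x y]
  abel

/-- A connection on `M` along `L` whose curvature vanishes, that is, a representation of the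
Lie–Rinehart algebra `L` on `M`. -/
structure IsFlatConnection [LieRingModule L A] (E : L →ₗ[A] (M →+ M)) : Prop where
  isConnection : IsConnection LinearMap.id E
  isFlatAt (m : M) : IsFlatAt E m

section Perturbation

variable (C : L →ₗ[A] (SymmetricAlgebra A L →+ SymmetricAlgebra A L))
  (B : SymmetricAlgebra A L →ₗ[A] L →ₗ[A] SymmetricAlgebra A L)

/-- The operators `p ↦ C x p + x p + B p x` on `S(L)`. -/
def perturb : L →ₗ[A] (SymmetricAlgebra A L →+ SymmetricAlgebra A L) where
  toFun x := C x + (LinearMap.mulLeft A (ι A L x) + B.flip x).toAddMonoidHom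
  map_add' x y := AddMonoidHom.ext fun p => by simp [add_mul]; abel
  map_smul' a x := AddMonoidHom.ext fun p => by simp

theorem perturb_apply (x : L) (p : SymmetricAlgebra A L) :
    perturb C B x p = C x p + (ι A L x * p + B p x) := rfl

variable {C} in
theorem IsConnection.perturb [LieRingModule L A] (hC : IsConnection LinearMap.id C) :
    IsConnection LinearMap.id (perturb C B) := fun x a p => by
  simp only [perturb_apply, hC x, mul_smul_comm, map_smul, LinearMap.smul_apply, smul_add]
  abel

/-- The obstruction to the flatness of `perturb C B`. It is arranged in such a way that its value at
an element of degree `n` involves `B` in degrees at most `n` only, so that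
`isFlatAt_perturb_iff` determines `B` recursively. -/
def obstruction (x y : L) (p : SymmetricAlgebra A L) : SymmetricAlgebra A L :=
  perturb C B ⁅x, y⁆ p - perturb C B x (perturb C B y p - ι A L y * p) +
    perturb C B y (perturb C B x p - ι A L x * p) - C x (ι A L y * p) + C y (ι A L x * p)

theorem isFlatAt_perturb_iff {p : SymmetricAlgebra A L} :
    IsFlatAt (perturb C B) p ↔
      ∀ x y, B (ι A L y * p) x - B (ι A L x * p) y = obstruction C B x y p := by
  refine forall₂_congr fun x y => ?_
  rw [obstruction, map_sub, map_sub, perturb_apply C B x (ι A L y * p),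
    perturb_apply C B y (ι A L x * p), mul_left_comm (ι A L y)]
  constructor <;> intro h <;> linear_combination -h

theorem obstruction_swap (x y : L) (p : SymmetricAlgebra A L) :
    obstruction C B y x p = -obstruction C B x y p := by
  unfold obstruction
  rw [← lie_skew x y, map_neg, AddMonoidHom.neg_apply]
  abel

theorem obstruction_add (x y : L) (p q : SymmetricAlgebra A L) :
    obstruction C B x y (p + q) = obstruction C B x y p + obstruction C B x y q := by
  simp only [obstruction, map_add, mul_add, map_sub]
  abel

theorem obstruction_add_right (x y z : L) (p : SymmetricAlgebra A L) :
    obstruction C B x (y + z) p = obstruction C B x y p + obstruction C B x z p := by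
  simp only [obstruction, map_add, add_mul, map_sub, lie_add, AddMonoidHom.add_apply]
  abel

theorem obstruction_add_left (x y z : L) (p : SymmetricAlgebra A L) :
    obstruction C B (x + y) z p = obstruction C B x z p + obstruction C B y z p := by
  simp only [obstruction_swap C B z, obstruction_add_right, neg_add]

variable {C} [LieRingModule L A]

theorem obstruction_smul (hC : IsConnection LinearMap.id C) (a : A) (x y : L)
    (p : SymmetricAlgebra A L) :
    obstruction C B x y (a • p) = a • obstruction C B x y p := by
  simp only [obstruction, mul_smul_comm, hC _ a, hC.perturb B _ a, map_sub, map_add,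
    hC.perturb B _ ⁅y, a⁆, hC.perturb B _ ⁅x, a⁆, LinearMap.id_apply, lie_lie x y a]
  module

variable [LieRinehartRing A L]

theorem obstruction_smul_right (hC : IsConnection LinearMap.id C) (a : A) (x y : L)
    (p : SymmetricAlgebra A L) :
    obstruction C B x (a • y) p = a • obstruction C B x y p := by
  simp only [obstruction, map_smul, smul_mul_assoc, hC _ a, hC.perturb B _ a, map_sub, map_add,
    LieRinehartRing.leibniz_smul_right, LinearMap.id_apply, AddMonoidHom.add_apply,
    AddMonoidHom.smul_apply]
  module

theorem obstruction_smul_left (hC : IsConnection LinearMap.id C) (a : A) (x y : L)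
    (p : SymmetricAlgebra A L) :
    obstruction C B (a • x) y p = a • obstruction C B x y p := by
  simp only [obstruction_swap C B y, obstruction_smul_right B hC, smul_neg]

/-- The trilinear obstruction as the map `p ⊗ y ↦ (x ↦ obstruction C B x y p)`. -/
def contractObstruction (hC : IsConnection LinearMap.id C) :
    SymmetricAlgebra A L ⊗[A] L →ₗ[A] L →ₗ[A] SymmetricAlgebra A L :=
  TensorProduct.lift <| LinearMap.mk₂ A
    (fun p y =>
      { toFun := fun x => obstruction C B x y p
        map_add' := fun x z => obstruction_add_left C B x z y p
        map_smul' := fun a x => obstruction_smul_left B hC a x y p })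
    (fun p q y => LinearMap.ext fun x => obstruction_add C B x y p q)
    (fun a p y => LinearMap.ext fun x => obstruction_smul B hC a x y p)
    (fun p y z => LinearMap.ext fun x => obstruction_add_right C B x y z p)
    (fun a p y => LinearMap.ext fun x => obstruction_smul_right B hC a x y p)

@[simp]
theorem contractObstruction_tmul (hC : IsConnection LinearMap.id C) (p : SymmetricAlgebra A L)
    (y x : L) : contractObstruction B hC (p ⊗ₜ y) x = obstruction C B x y p := rfl

end Perturbation

section Bianchi

variable {C : L →ₗ[A] (SymmetricAlgebra A L →+ SymmetricAlgebra A L)}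
  {B : SymmetricAlgebra A L →ₗ[A] L →ₗ[A] SymmetricAlgebra A L}

theorem perturb_sub_swap {p : SymmetricAlgebra A L} (hp : IsFlatAt (perturb C B) p) (x y : L) :
    (perturb C B x (ι A L y * p) - ι A L x * (ι A L y * p)) -
        (perturb C B y (ι A L x * p) - ι A L y * (ι A L x * p)) =
      perturb C B ⁅x, y⁆ p - perturb C B x (perturb C B y p - ι A L y * p) +
        perturb C B y (perturb C B x p - ι A L x * p) := by
  rw [hp x y, map_sub, map_sub]
  ring

theorem lie_jacobi_apply (E : L →ₗ[A] (M →+ M)) (x y z : L) (m : M) :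
    E ⁅⁅x, y⁆, z⁆ m + E ⁅⁅y, z⁆, x⁆ m + E ⁅⁅z, x⁆, y⁆ m = 0 := by
  have jacobi : ⁅⁅x, y⁆, z⁆ + ⁅⁅y, z⁆, x⁆ + ⁅⁅z, x⁆, y⁆ = 0 := by
    rw [← neg_eq_zero, neg_add, neg_add, lie_skew, lie_skew, lie_skew]
    exact lie_jacobi z x y
  rw [← AddMonoidHom.add_apply, ← map_add, ← AddMonoidHom.add_apply, ← map_add, jacobi, map_zero,
    AddMonoidHom.zero_apply]

/-- The Bianchi identity. -/
theorem obstruction_cyclic {p : SymmetricAlgebra A L} (hp : IsFlatAt (perturb C B) p)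
    (hp' : ∀ x, IsFlatAt (perturb C B) (perturb C B x p - ι A L x * p)) (x y z : L) :
    obstruction C B x y (ι A L z * p) + obstruction C B y z (ι A L x * p) +
      obstruction C B z x (ι A L y * p) = 0 := by
  have apply_swap (x y z : L) := congrArg (perturb C B x) (perturb_sub_swap hp y z)
  simp only [map_sub, map_add] at apply_swap
  have flat (x y z : L) := hp' z x y
  simp only [map_sub] at flat
  have mul_swap (x y z : L) : C x (ι A L y * (ι A L z * p)) = C x (ι A L z * (ι A L y * p)) := by
    rw [mul_left_comm]
  have jacobi := lie_jacobi_apply (perturb C B) x y z p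
  simp only [obstruction, map_sub]
  linear_combination -apply_swap x y z - apply_swap y z x - apply_swap z x y - flat x y z -
    flat y z x - flat z x y - hp ⁅x, y⁆ z - hp ⁅y, z⁆ x - hp ⁅z, x⁆ y + jacobi -
    mul_swap x y z - mul_swap y z x - mul_swap z x y

end Bianchi

section FixedPoint

variable [LieRingModule L A] {C : L →ₗ[A] (SymmetricAlgebra A L →+ SymmetricAlgebra A L)}
  {B B' : SymmetricAlgebra A L →ₗ[A] L →ₗ[A] SymmetricAlgebra A L}

/-- The values of `B` at elements of degree less than `n` are maps with values in degrees less
than `n`. -/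
def PreservesDegree (B : SymmetricAlgebra A L →ₗ[A] L →ₗ[A] SymmetricAlgebra A L) : Prop :=
  ∀ n, degreeLT A L n ≤ (Submodule.compatibleMaps ⊤ (degreeLT A L n)).comap B

theorem IsGradedConnection.hasMulSymbol_perturb (hC : IsGradedConnection LinearMap.id 1 C)
    (hB : PreservesDegree B) : HasMulSymbol (perturb C B) := fun n x p hp => by
  rw [perturb_apply, add_sub_assoc, add_sub_cancel_left]
  exact add_mem (hC.mem_degreeLT n x p hp) (hB n hp trivial)

omit [LieRingModule L A] in
theorem HasMulSymbol.apply_mem {E : L →ₗ[A] (SymmetricAlgebra A L →+ SymmetricAlgebra A L)}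
    (hE : HasMulSymbol E) {n : ℕ} (x : L) {p : SymmetricAlgebra A L} (hp : p ∈ degreeLT A L n) :
    E x p ∈ degreeLT A L (n + 1) := by
  simpa only [sub_add_cancel] using
    add_mem (weightLT_le_succ 1 n (hE n x p hp)) (ι_mul_mem_weightLT 1 x hp)

theorem obstruction_mem (hC : IsGradedConnection LinearMap.id 1 C) (hB : PreservesDegree B)
    {n : ℕ} (x y : L) {p : SymmetricAlgebra A L} (hp : p ∈ degreeLT A L n) :
    obstruction C B x y p ∈ degreeLT A L (n + 1) := by
  have hE := hC.hasMulSymbol_perturb hB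
  exact add_mem (sub_mem (add_mem (sub_mem (hE.apply_mem _ hp) (hE.apply_mem x (hE n y p hp)))
    (hE.apply_mem y (hE n x p hp))) (hC.mem_degreeLT _ x _ (ι_mul_mem_weightLT 1 y hp)))
    (hC.mem_degreeLT _ y _ (ι_mul_mem_weightLT 1 x hp))

theorem obstruction_congr (hC : IsGradedConnection LinearMap.id 1 C) (hB : PreservesDegree B)
    {n : ℕ} (h : Set.EqOn B B' (degreeLT A L n)) (x y : L) {p : SymmetricAlgebra A L}
    (hp : p ∈ degreeLT A L n) : obstruction C B x y p = obstruction C B' x y p := by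
  have hE := hC.hasMulSymbol_perturb hB
  have perturb_congr (x) {q} (hq : q ∈ degreeLT A L n) : perturb C B x q = perturb C B' x q := by
    rw [perturb_apply, perturb_apply, h hq]
  rw [obstruction, obstruction, perturb_congr x (hE n y p hp), perturb_congr y (hE n x p hp),
    perturb_congr _ hp, perturb_congr _ hp, perturb_congr _ hp]

variable [LieRinehartRing A L] [Algebra ℚ A]

theorem exists_fixedPoint_contractObstruction (hC : IsGradedConnection LinearMap.id 1 C) :
    ∃ B : SymmetricAlgebra A L →ₗ[A] L →ₗ[A] SymmetricAlgebra A L, PreservesDegree B ∧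
      ∀ p, contractObstruction B hC.isConnection (diff 1 (divWeight 1 1 p)) = B p := by
  refine (exists_fixedPoint .one
    (fun n => Submodule.compatibleMaps ⊤ (degreeLT A L n))
    (fun B => contractObstruction B hC.isConnection ∘ₗ
      (diff (1 : Module.End A L)).toLinearMap ∘ₗ divWeight 1 1)
    (fun B hB n p hp => ?_) (fun B B' hB _ n h p hp => ?_)).imp fun B hB =>
      ⟨hB.1, LinearMap.congr_fun hB.2⟩
  · rcases n with - | n
    · rw [eq_zero_of_mem_weightLT_zero hp]
      exact zero_mem _
    · exact diff_induction (motive := fun s => contractObstruction B hC.isConnection s ∈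
          Submodule.compatibleMaps ⊤ (degreeLT A L (n + 1))) (mul_one 1) .one
        (divWeight_mem_weightLT .one 1 hp) (by rw [map_zero]; exact zero_mem _)
        (fun s t hs ht => by rw [map_add]; exact add_mem hs ht)
        fun p y hp x _ => obstruction_mem hC hB x y hp
  · exact diff_induction (motive := fun s => contractObstruction B hC.isConnection s =
        contractObstruction B' hC.isConnection s) (mul_one 1) .one
      (divWeight_mem_weightLT .one 1 hp) (by simp)
      (fun s t hs ht => by rw [map_add, map_add, hs, ht])
      fun p y hp => LinearMap.ext fun x => obstruction_congr hC hB h x y hp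

theorem nsmul_apply_ι_mul (hC : IsConnection LinearMap.id C)
    (hB : ∀ p, contractObstruction B hC (diff 1 (divWeight 1 1 p)) = B p) {n : ℕ}
    {p : SymmetricAlgebra A L} (hp : weightProj 1 n p = p) (x y : L) :
    (n + 2) • B (ι A L y * p) x =
      obstruction C B x y p + contractObstruction B hC (ι A L y • diff 1 p) x := by
  have homogeneous : weightProj 1 (n + 1) (ι A L y * p) = ι A L y * p := by
    simp [weightProj_succ_ι_mul, hp]
  rw [← hB, ← homogeneous, divWeight_weightProj .one, Derivation.map_smul, map_smul, homogeneous,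
    LinearMap.smul_apply, smul_comm, algebraMap_inv_smul_nsmul (n + 1).succ_ne_zero, diff_ι_mul,
    map_add, LinearMap.add_apply, contractObstruction_tmul]
  rfl

omit [Algebra ℚ A] in
theorem contractObstruction_antisymm (hC : IsGradedConnection LinearMap.id 1 C)
    (hB : PreservesDegree B) {n : ℕ} (hflat : ∀ q ∈ degreeLT A L n, IsFlatAt (perturb C B) q)
    {p : SymmetricAlgebra A L} (hp : weightProj 1 n p = p) (x y : L) :
    contractObstruction B hC.isConnection (ι A L y • diff 1 p) x -
        contractObstruction B hC.isConnection (ι A L x • diff 1 p) y =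
      n • obstruction C B x y p := by
  have euler := contract_diff_weightProj .one n p
  rw [hp] at euler
  have hp' : p ∈ degreeLT A L (n + 1) := hp ▸ weightProj_mem_weightLT_of_lt .one n.lt_succ_self p
  suffices h : contractObstruction B hC.isConnection (ι A L y • diff 1 p) x -
      contractObstruction B hC.isConnection (ι A L x • diff 1 p) y =
        contractObstruction B hC.isConnection (contract 1 (diff 1 p) ⊗ₜ y) x by
    rw [h, euler, ← TensorProduct.smul_tmul', map_nsmul, LinearMap.smul_apply,
      contractObstruction_tmul]
  refine diff_induction (motive := fun s => contractObstruction B hC.isConnection (ι A L y • s) x -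
    contractObstruction B hC.isConnection (ι A L x • s) y =
      contractObstruction B hC.isConnection (contract 1 s ⊗ₜ y) x) (mul_one 1) .one hp'
    (by simp) (fun s t hs ht => ?_) fun q z hq => ?_
  · simp only [smul_add, map_add, TensorProduct.add_tmul, LinearMap.add_apply, ← hs, ← ht]
    abel
  · have bianchi := obstruction_cyclic (hflat q hq)
      (fun x => hflat _ (hC.hasMulSymbol_perturb hB n x q hq)) x z y
    rw [obstruction_swap C B y z, obstruction_swap C B x y] at bianchi
    simp only [TensorProduct.smul_tmul', smul_eq_mul, contractObstruction_tmul, contract_tmul,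
      Module.End.one_apply]
    linear_combination bianchi

theorem isFlatAt_of_fixedPoint (hC : IsGradedConnection LinearMap.id 1 C) (hB : PreservesDegree B)
    (hB' : ∀ p, contractObstruction B hC.isConnection (diff 1 (divWeight 1 1 p)) = B p) (n : ℕ) :
    ∀ q ∈ degreeLT A L n, IsFlatAt (perturb C B) q := by
  induction n with
  | zero =>
    intro q hq x y
    simp [eq_zero_of_mem_weightLT_zero hq]
  | succ n ih =>
    intro q hq
    refine induction_weight (motive := IsFlatAt (perturb C B)) 1 q (fun x y => by simp)
      (fun p q => .add) fun i => ?_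
    rcases lt_or_ge n i with hi | hi
    · rw [mem_weightLT.1 hq i hi]
      exact fun x y => by simp
    rw [isFlatAt_perturb_iff]
    intro x y
    set p := weightProj 1 i q
    have hp : weightProj 1 i p = p := weightProj_self .one i q
    have hxy := nsmul_apply_ι_mul hC.isConnection hB' hp x y
    have hyx := nsmul_apply_ι_mul hC.isConnection hB' hp y x
    have antisymm := contractObstruction_antisymm hC hB
      (fun q hq => ih q (weightLT_mono 1 hi hq)) hp x y
    rw [obstruction_swap C B x y] at hyx
    refine sub_eq_zero.1 ((Submodule.mem_bot A).1 (mem_of_nsmul_mem (i + 1).succ_ne_zero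
      ((Submodule.mem_bot A).2 ?_)))
    simp only [nsmul_eq_mul, Nat.succ_eq_add_one] at hxy hyx antisymm ⊢
    push_cast at hxy hyx ⊢
    linear_combination hxy - hyx + antisymm

variable (A L) in
theorem exists_isFlatConnection_hasMulSymbol [Module.Projective A L] :
    ∃ E : L →ₗ[A] (SymmetricAlgebra A L →+ SymmetricAlgebra A L),
      IsFlatConnection E ∧ HasMulSymbol E := by
  obtain ⟨C, hC⟩ := exists_isGradedConnection (A := A) L (W := L) .one
  obtain ⟨B, hB, hB'⟩ := exists_fixedPoint_contractObstruction hC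
  refine ⟨perturb C B, ⟨hC.isConnection.perturb B, fun q => ?_⟩, hC.hasMulSymbol_perturb hB⟩
  obtain ⟨n, hn⟩ := exists_mem_weightLT 1 q
  exact isFlatAt_of_fixedPoint hC hB hB' n q hn

end FixedPoint

end FlatConnection

section Modules

variable {k A L : Type*} [CommRing k] [CommRing A] [Algebra k A] [LieRing L] [LieAlgebra k L]
  [Module A L] [LieRingModule L A]

/-- A `U_A(L)`-module viewed as an `A`-module along `ιA`. The type synonym keeps this `A`-module
structure apart from the one by right multiplication on `RightReg k A L`. -/
def Restr (_k _A _L M : Type*) : Type _ := M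

variable {M N : Type*} [AddCommGroup M] [Module (UEA k A L) M] [AddCommGroup N]
  [Module (UEA k A L) N]

instance (k A L M : Type*) [AddCommGroup M] : AddCommGroup (Restr k A L M) :=
  inferInstanceAs (AddCommGroup M)

instance : Module (UEA k A L) (Restr k A L M) := inferInstanceAs (Module (UEA k A L) M)

instance : Module A (Restr k A L M) := Module.compHom _ (ιA k A L).toRingHom

theorem ιA_smul (a : A) (m : Restr k A L M) : ιA k A L a • m = a • m := rfl

instance : LinearMap.CompatibleSMul (Restr k A L M) (Restr k A L N) A (UEA k A L) :=
  ⟨fun f a m => f.map_smul (ιA k A L a) m⟩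

theorem smul_mem_of_forall_ιL_mem {N : Submodule A (Restr k A L M)}
    (hN : ∀ x, ∀ m ∈ N, ιL k A L x • m ∈ N) (u : UEA k A L) {m : Restr k A L M} (hm : m ∈ N) :
    u • m ∈ N := by
  obtain ⟨t, rfl⟩ : ∃ t, mk k A L t = u := RingQuot.mkAlgHom_surjective k (Rel k A L) u
  induction t using TensorAlgebra.induction generalizing m with
  | algebraMap c =>
    rw [AlgHom.commutes, ← (ιA k A L).commutes]
    exact N.smul_mem _ hm
  | ι y =>
    have split : mk k A L (TensorAlgebra.ι k y) = ιA k A L y.1 + ιL k A L y.2 := by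
      rw [ιA_apply, ιL_apply, ← map_add, ← map_add, Prod.mk_add_mk, zero_add, add_zero]
    rw [split, add_smul]
    exact add_mem (N.smul_mem _ hm) (hN _ m hm)
  | mul s t hs ht => rw [map_mul, mul_smul]; exact hs (ht hm)
  | add s t hs ht => rw [map_add, add_smul]; exact add_mem (hs hm) (ht hm)

theorem eq_top_of_forall_ιL_mem {N : Submodule A (Restr k A L M)}
    (hN : ∀ x, ∀ m ∈ N, ιL k A L x • m ∈ N) {S : Set (Restr k A L M)}
    (hS : Submodule.span (UEA k A L) S = ⊤) (hSN : S ⊆ N) : N = ⊤ := by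
  let N' : Submodule (UEA k A L) (Restr k A L M) :=
    { N.toAddSubmonoid with smul_mem' := fun u _ hm => smul_mem_of_forall_ιL_mem hN u hm }
  have hN' : N' = ⊤ := top_le_iff.1 (hS ▸ Submodule.span_le.2 hSN)
  exact eq_top_iff.2 fun m _ => (hN' ▸ Submodule.mem_top : m ∈ N')

variable (k A L M) in
/-- The action of `L` on a `U_A(L)`-module. -/
def leftAct : L →ₗ[A] (Restr k A L M →+ Restr k A L M) where
  toFun x := DistribSMul.toAddMonoidHom _ (ιL k A L x)
  map_add' x y := by ext m; simp [add_smul]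
  map_smul' a x := by ext m; simp [ιL_smul, mul_smul, ιA_smul]

theorem leftAct_apply (x : L) (m : Restr k A L M) : leftAct k A L M x m = ιL k A L x • m := rfl

variable (k A L M) in
theorem isFlatConnection_leftAct : IsFlatConnection (leftAct k A L M) where
  isConnection x a m := by
    simp only [leftAct_apply, ← ιA_smul, LinearMap.id_apply, ← ιL_mul_ιA_sub, smul_smul,
      sub_smul, add_sub_cancel]
  isFlatAt m x y := by simp only [leftAct_apply, ιL_lie, sub_smul, smul_smul]

end Modules

section Representation

variable {k A L X : Type*} [CommRing k] [CommRing A] [Algebra k A] [LieRing L] [LieAlgebra k L]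
  [Module A L] [LieRingModule L A] [AddCommGroup X] [Module A X]

theorem IsFlatConnection.isActionAlong {W : Type*} [AddCommGroup W] [Module A W]
    {E : L →ₗ[A] (X →+ X)} (hE : IsFlatConnection E) {t : W →ₗ[A] L}
    (ht : Function.Surjective t) {e : Module.End A W} (he : t ∘ₗ e = t) :
    IsActionAlong t e (E ∘ₗ t) where
  isConnection := hE.isConnection.comp t
  apply_idempotent w := congrArg E (LinearMap.congr_fun he w)
  exists_commutator v w := by
    obtain ⟨z, hz⟩ := ht ⁅t v, t w⁆
    refine ⟨z, fun m => ?_⟩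
    simp only [LinearMap.comp_apply, hz, hE.isFlatAt m (t v) (t w), add_sub_cancel]

variable [LieRinehartRing A L] [LieRinehartAlgebra k A L]

section BaseRing

variable [Module k X] [IsScalarTower k A X]

variable (k) in
theorem IsConnection.apply_base_smul {E : L →ₗ[A] (X →+ X)} (hE : IsConnection LinearMap.id E)
    (x : L) (c : k) (q : X) : E x (c • q) = c • E x q := by
  have anchor_algebraMap : ⁅x, algebraMap k A c⁆ = 0 :=
    (LieRinehartAlgebra.anchor k A L x).map_algebraMap c
  rw [← algebraMap_smul A c q, hE, LinearMap.id_apply, anchor_algebraMap, zero_smul, add_zero,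
    algebraMap_smul]

variable (k) in
/-- The `k`-linear operators underlying a connection. -/
def IsConnection.toEnd {E : L →ₗ[A] (X →+ X)} (hE : IsConnection LinearMap.id E) :
    L →ₗ[k] Module.End k X where
  toFun x := { E x with map_smul' := hE.apply_base_smul k x }
  map_add' x y := LinearMap.ext fun q => DFunLike.congr_fun (map_add E x y) q
  map_smul' c x := LinearMap.ext fun q => by
    change E (c • x) q = c • E x q
    rw [← algebraMap_smul A c x, map_smul, ← algebraMap_smul A c]
    rfl

end BaseRing

namespace IsFlatConnection

variable {E : L →ₗ[A] (X →+ X)} (hE : IsFlatConnection E)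

variable (k) in
/-- The representation of `U_A(L)` that corresponds to a flat connection. It takes values in the
additive endomorphisms, so that `X` need not come with a `k`-module structure. -/
def rep : UEA k A L →+* AddMonoid.End X :=
  letI : Module k X := Module.compHom X (algebraMap k A)
  haveI : IsScalarTower k A X := .of_compHom k A X
  (Module.toAddMonoidEnd (Module.End k X) X).comp <| RingHomClass.toRingHom <|
    lift (Algebra.lsmul k k X) (hE.isConnection.toEnd k)
      (fun x y => LinearMap.ext fun q => hE.isFlatAt q x y)
      (fun a x => LinearMap.ext fun q => DFunLike.congr_fun (map_smul E a x) q)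
      (fun x a => LinearMap.ext fun q => sub_eq_of_eq_add' (hE.isConnection x a q))

theorem rep_ιA (a : A) (q : X) : hE.rep k (ιA k A L a) q = a • q := by
  let : Module k X := Module.compHom X (algebraMap k A)
  have : IsScalarTower k A X := .of_compHom k A X
  exact LinearMap.congr_fun (lift_ιA (Algebra.lsmul k k X) _ _ _ _ a) q

theorem rep_ιL (x : L) (q : X) : hE.rep k (ιL k A L x) q = E x q := by
  let : Module k X := Module.compHom X (algebraMap k A)
  have : IsScalarTower k A X := .of_compHom k A X
  exact LinearMap.congr_fun (lift_ιL (Algebra.lsmul k k X) (hE.isConnection.toEnd k) _ _ _ x) q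

variable (k) in
/-- The map `u ↦ u q` from `U_A(L)` to a representation. -/
def orbit (q : X) : Restr k A L (UEA k A L) →ₗ[A] X where
  toFun u := hE.rep k u q
  map_add' u v := DFunLike.congr_fun (map_add (hE.rep k) u v) q
  map_smul' a u := by
    rw [RingHom.id_apply, ← hE.rep_ιA (k := k)]
    exact DFunLike.congr_fun (map_mul (hE.rep k) (ιA k A L a) u) q

theorem orbit_one (q : X) : hE.orbit k q (1 : UEA k A L) = q :=
  DFunLike.congr_fun (map_one (hE.rep k)) q

theorem orbit_ιL_smul (q : X) (x : L) (u : Restr k A L (UEA k A L)) :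
    hE.orbit k q (ιL k A L x • u) = E x (hE.orbit k q u) := by
  rw [← hE.rep_ιL (k := k)]
  exact DFunLike.congr_fun (map_mul (hE.rep k) _ _) q

end IsFlatConnection

end Representation

section PoincareBirkhoffWitt

variable {k A L : Type*} [CommRing k] [CommRing A] [Algebra k A] [LieRing L] [LieAlgebra k L]
  [Module A L] [LieRingModule L A] [LieRinehartRing A L] [LieRinehartAlgebra k A L]

theorem IsFlatConnection.orbit_one_bijective [Algebra ℚ A] [Module.Projective A L]
    {E : L →ₗ[A] (SymmetricAlgebra A L →+ SymmetricAlgebra A L)} (hE : IsFlatConnection E)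
    (hE' : HasMulSymbol E) : Function.Bijective (hE.orbit k 1) := by
  let one : Restr k A L (UEA k A L) := (1 : UEA k A L)
  have orbit_one : hE.orbit k 1 one = 1 := hE.orbit_one 1
  have span_one : Submodule.span (UEA k A L) {one} = ⊤ := Ideal.span_singleton_one (α := UEA k A L)
  refine bijective_of_intertwiner .one
    ((isFlatConnection_leftAct k A L (UEA k A L)).isActionAlong (t := .id) Function.surjective_id
      rfl) hE' (fun x u => hE.orbit_ιL_smul 1 x u)
    (f := (LinearMap.toSpanSingleton A _ one) ∘ₗ SymmetricAlgebra.algebraMapInv.toLinearMap)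
    (fun q => ?_) fun N hN hL => ?_
  · rw [weightProj_one_zero]
    simp [orbit_one, Algebra.algebraMap_eq_smul_one]
  · refine eq_top_of_forall_ιL_mem hL span_one (Set.singleton_subset_iff.2 ?_)
    simpa [weightProj_one_zero] using hN 1

end PoincareBirkhoffWitt

section InducedModules

section Bimodule

variable {U A P X Y : Type*} [Ring U] [CommRing A] [AddCommGroup P] [Module U P] [Module A P]
  [SMulCommClass A U P] [AddCommGroup X] [Module A X] [AddCommGroup Y] [Module U Y]

/-- An additive map out of `P ⊗[A] X`, for a `(U, A)`-bimodule `P`, that is `U`-linear on pure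
tensors, as a `U`-linear map. -/
def tensorLinearMap (f : P ⊗[A] X →+ Y)
    (hf : ∀ (u : U) p x, f ((u • p) ⊗ₜ x) = u • f (p ⊗ₜ x)) : P ⊗[A] X →ₗ[U] Y where
  __ := f
  map_smul' u z := by
    change f (u • z) = u • f z
    induction z with
    | zero => simp only [smul_zero, map_zero]
    | tmul p x => rw [TensorProduct.smul_tmul', hf]
    | add y z hy hz => rw [smul_add, map_add, map_add, smul_add, hy, hz]

theorem projective_tensorProduct [Module.Projective U P] [Module.Projective A X] :
    Module.Projective U (P ⊗[A] X) := by
  classical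
  obtain ⟨s, hs⟩ := Module.projective_def'.1 (‹Module.Projective A X›)
  have : Module.Projective U (X →₀ P) := .of_equiv (finsuppLequivDFinsupp U).symm
  let free : P ⊗[A] (X →₀ A) ≃+ (X →₀ P) :=
    (TensorProduct.finsuppScalarRight A A P X).toAddEquiv
  have free_smul (u : U) (p : P) (c : X →₀ A) : free ((u • p) ⊗ₜ c) = u • free (p ⊗ₜ c) :=
    Finsupp.ext fun x => by
      simp [free, TensorProduct.finsuppScalarRight_apply_tmul_apply, smul_comm]
  have : Module.Projective U (P ⊗[A] (X →₀ A)) :=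
    .of_equiv (LinearEquiv.ofBijective (tensorLinearMap free.toAddMonoidHom free_smul)
      free.bijective).symm
  refine .of_split (M := P ⊗[A] (X →₀ A))
    (tensorLinearMap (s.lTensor P).toAddMonoidHom fun u p x => rfl)
    (tensorLinearMap ((Finsupp.linearCombination A id).lTensor P).toAddMonoidHom
      fun u p c => rfl) (LinearMap.ext fun z => ?_)
  exact LinearMap.congr_fun ((LinearMap.lTensor_comp P _ s).symm.trans
    (by rw [hs, LinearMap.lTensor_id])) z

end Bimodule

variable {k A L : Type*} [CommRing k] [CommRing A] [Algebra k A] [LieRing L] [LieAlgebra k L]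
  [Module A L] [LieRingModule L A] {X V : Type*} [AddCommGroup X] [Module A X] [AddCommGroup V]
  [Module (UEA k A L) V]

variable (k A L) in
theorem projective_rightReg_tensorProduct [Module.Projective A X] :
    Module.Projective (UEA k A L) (RightReg k A L ⊗[A] X) :=
  have : Module.Projective (UEA k A L) (RightReg k A L) :=
    inferInstanceAs (Module.Projective (UEA k A L) (UEA k A L))
  projective_tensorProduct

variable (k A L X) in
/-- The `U_A(L)`-module induced by an `A`-module. -/
abbrev Induced : Type _ := Restr k A L (RightReg k A L ⊗[A] X)

variable (k A L) in
/-- The isomorphism of the two versions of the regular left module of `U_A(L)`. -/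
def toUEA : RightReg k A L ≃ₗ[UEA k A L] UEA k A L := .refl (UEA k A L) (UEA k A L)

theorem toUEA_smul (a : A) (u : RightReg k A L) :
    toUEA k A L (a • u) = toUEA k A L u * ιA k A L a := rfl

theorem ιA_smul_one (a : A) :
    ιA k A L a • (toUEA k A L).symm 1 = a • (toUEA k A L).symm 1 :=
  (toUEA k A L).injective (by simp [toUEA_smul])

variable (k A L X) in
/-- The map `x ↦ 1 ⊗ x`. -/
def toInduced : X →ₗ[A] Induced k A L X where
  toFun x := (toUEA k A L).symm 1 ⊗ₜ[A] x
  map_add' x y := TensorProduct.tmul_add _ x y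
  map_smul' a x := by
    change _ = ιA k A L a • (toUEA k A L).symm 1 ⊗ₜ[A] x
    rw [TensorProduct.smul_tmul', ιA_smul_one, TensorProduct.smul_tmul]

theorem span_range_toInduced :
    Submodule.span (UEA k A L) (Set.range (toInduced k A L X)) = ⊤ := by
  refine Submodule.eq_top_iff'.2 fun z => ?_
  induction z using TensorProduct.induction_on with
  | zero => exact zero_mem _
  | add y z hy hz => exact add_mem hy hz
  | tmul u x =>
    have eq_smul : u ⊗ₜ[A] x = toUEA k A L u • (toUEA k A L).symm 1 ⊗ₜ[A] x := by
      rw [TensorProduct.smul_tmul', ← map_smul, smul_eq_mul, mul_one, LinearEquiv.symm_apply_apply]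
    exact eq_smul ▸ Submodule.smul_mem _ _ (Submodule.subset_span ⟨x, rfl⟩)

/-- The morphism of `U_A(L)`-modules induced by an `A`-linear map. -/
def inducedHom (φ : X →ₗ[A] Restr k A L V) : Induced k A L X →ₗ[UEA k A L] Restr k A L V :=
  tensorLinearMap
    (TensorProduct.liftAddHom
      { toFun u :=
          (DistribSMul.toAddMonoidHom (Restr k A L V) (toUEA k A L u)).comp φ.toAddMonoidHom
        map_zero' := by ext x; simp
        map_add' u v := by ext x; simp [add_smul] }
      fun a u x => by simp [toUEA_smul, mul_smul, ιA_smul])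
    fun u v x => by simp [mul_smul]

theorem inducedHom_toInduced (φ : X →ₗ[A] Restr k A L V) (x : X) :
    inducedHom φ (toInduced k A L X x) = φ x := one_smul (UEA k A L) (φ x)

end InducedModules

section Relative

variable {A L : Type*} [CommRing A] [LieRing L] [Module A L] {H : LieRinehartSubalgebra A L}

theorem exists_section_retraction [Module.Projective A (L ⧸ H.toSubmodule)] :
    ∃ (s : L ⧸ H.toSubmodule →ₗ[A] L) (r : L →ₗ[A] H), H.toSubmodule.mkQ ∘ₗ s = LinearMap.id ∧
      (∀ h : H, r h = h) ∧ ∀ x, (r x : L) = x - s (H.toSubmodule.mkQ x) := by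
  obtain ⟨s, hs⟩ := Module.projective_lifting_property H.toSubmodule.mkQ LinearMap.id
    H.toSubmodule.mkQ_surjective
  let r : L →ₗ[A] H := (LinearMap.id - s ∘ₗ H.toSubmodule.mkQ).codRestrict H.toSubmodule
    fun x => (Submodule.Quotient.mk_eq_zero _).1 (by
      simpa [sub_eq_zero] using (LinearMap.congr_fun hs (H.toSubmodule.mkQ x)).symm)
  refine ⟨s, r, hs, fun h => Subtype.ext ?_, fun x => rfl⟩
  change (h : L) - s (H.toSubmodule.mkQ h) = h
  rw [Submodule.mkQ_apply, (Submodule.Quotient.mk_eq_zero _).2 h.2, map_zero, sub_zero]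

variable {k : Type*} [CommRing k] [Algebra k A] [LieAlgebra k L] [LieRingModule L A]
  [LieRinehartRing A L] [LieRinehartAlgebra k A L]

theorem inducedHom_bijective [Algebra ℚ A] [Module.Projective A L] {V : Type*} [AddCommGroup V]
    [Module (UEA k A H) V] {E : L →ₗ[A] (SymmetricAlgebra A L →+ SymmetricAlgebra A L)}
    (hE : HasMulSymbol E) (O : Restr k A H V ≃ₗ[A] SymmetricAlgebra A L)
    (hO : ∀ (h : H) u, O (ιL k A H h • u) = E h (O u))
    {s : L ⧸ H.toSubmodule →ₗ[A] L} (hs : H.toSubmodule.mkQ ∘ₗ s = LinearMap.id)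
    {r : L →ₗ[A] H} (hr : ∀ h : H, r h = h)
    (hrs : ∀ x, (r x : L) = x - s (H.toSubmodule.mkQ x)) :
    Function.Bijective (inducedHom (O.symm.toLinearMap ∘ₗ (mapHom s).toLinearMap)) := by
  set q := H.toSubmodule.mkQ
  let φ := O.symm.toLinearMap ∘ₗ (mapHom s).toLinearMap
  -- the weights for `e` count the factors in `H`, and the part of weight zero is `S(L/H)`
  let e : Module.End A L := 1 - s ∘ₗ q
  have coe_r (x : L) : (r x : L) = e x := hrs x
  have proj_s : IsIdempotentElem (s ∘ₗ q) := LinearMap.ext fun x =>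
    congrArg s (LinearMap.congr_fun hs (q x))
  have he : IsIdempotentElem e := proj_s.one_sub
  have r_e : r ∘ₗ e = r := LinearMap.ext fun x => by
    rw [LinearMap.comp_apply, ← coe_r, hr]
  have map_e_zero (p) : weightProj e 0 p = mapHom s (mapHom q p) := by
    rw [weightProj_zero_eq_mapHom, mapHom_mapHom, sub_sub_cancel]
  suffices Function.Bijective (O.toLinearMap ∘ₗ (inducedHom φ).restrictScalars A) from
    (O.bijective.of_comp_iff' _).1 this
  have hT := (isFlatConnection_leftAct k A H
    (RightReg k A H ⊗[A] SymmetricAlgebra A (L ⧸ H.toSubmodule))).isActionAlong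
      (t := r) (fun h => ⟨h, hr h⟩) r_e
  refine bijective_of_intertwiner he hT hE (fun x m => ?_)
    (f := toInduced k A H _ ∘ₗ (mapHom q).toLinearMap) (fun p => ?_) fun N hN hH => ?_
  · rw [← coe_r]
    change O (inducedHom φ (ιL k A H (r x) • m)) = _
    rw [map_smul, hO]
    rfl
  · change O (inducedHom φ (toInduced k A H _ (mapHom q _))) = _
    rw [inducedHom_toInduced, map_e_zero, mapHom_mapHom, hs, mapHom_id]
    exact O.apply_symm_apply _
  · refine eq_top_of_forall_ιL_mem (fun h m hm => ?_) span_range_toInduced ?_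
    · simpa [hr, leftAct_apply] using hH h m hm
    · rintro _ ⟨p, rfl⟩
      simpa [map_e_zero, mapHom_mapHom, hs, mapHom_id] using hN (mapHom s p)

variable (H k) in
/-- `U_A(L)`, viewed as an `A`-module along `A → U_A(H)` and along `A → U_A(L)`. -/
def restrUEA : Restr k A H (UEA k A L) ≃ₗ[A] Restr k A L (UEA k A L) where
  __ := AddEquiv.refl (UEA k A L)
  map_smul' a u := congrArg (· * (show UEA k A L from u)) (map_ιA (H.incl k) a)

theorem restrUEA_ιL_smul (h : H) (u : Restr k A H (UEA k A L)) :
    restrUEA H k (ιL k A H h • u) = ιL k A L h • restrUEA H k u :=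
  congrArg (· * (show UEA k A L from u))
    ((map_ιL (H.incl k) h).trans (congrArg (ιL k A L) (congrFun (H.coe_incl k) h)))

theorem nonempty_equiv_rightReg_tensorProduct [Algebra ℚ A] [Module.Projective A L]
    [Module.Projective A (L ⧸ H.toSubmodule)] :
    Nonempty (UEA k A L ≃ₗ[UEA k A H]
      RightReg k A H ⊗[A] SymmetricAlgebra A (L ⧸ H.toSubmodule)) := by
  obtain ⟨E, hE, mul_symbol⟩ := exists_isFlatConnection_hasMulSymbol A L
  obtain ⟨s, r, hs, hr, hrs⟩ := exists_section_retraction (H := H)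
  let O : Restr k A H (UEA k A L) ≃ₗ[A] SymmetricAlgebra A L :=
    restrUEA H k ≪≫ₗ .ofBijective _ (hE.orbit_one_bijective (k := k) mul_symbol)
  have hO (h : H) (u) : O (ιL k A H h • u) = E h (O u) :=
    (congrArg (hE.orbit k 1) (restrUEA_ιL_smul h u)).trans (hE.orbit_ιL_smul 1 h _)
  exact ⟨(LinearEquiv.ofBijective _ (inducedHom_bijective mul_symbol O hO hs hr hrs)).symm⟩

end Relative

end LieRinehartPBW

end

theorem proposition1p10_general {k A L : Type*} [CommRing k] [CommRing A] [Algebra k A]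
    [Algebra ℚ A] [LieRing L] [LieAlgebra k L] [Module A L] [LieRingModule L A]
    [LieRinehartRing A L] [LieRinehartAlgebra k A L] (H : LieRinehartSubalgebra A L)
    [Module.Projective A L] [Module.Projective A (L ⧸ H.toSubmodule)] :
    Nonempty (LieRinehartUEA.UEA k A L ≃ₗ[LieRinehartUEA.UEA k A H]
      LieRinehartUEA.RightReg k A H ⊗[A] SymmetricAlgebra A (L ⧸ H.toSubmodule)) ∧
    Module.Projective (LieRinehartUEA.UEA k A H) (LieRinehartUEA.UEA k A L) := by
  obtain ⟨f⟩ := LieRinehartPBW.nonempty_equiv_rightReg_tensorProduct (k := k) (H := H)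
  have := LieRinehartPBW.projective_rightReg_tensorProduct k A H
    (X := SymmetricAlgebra A (L ⧸ H.toSubmodule))
  exact ⟨⟨f⟩, .of_equiv f.symm⟩

theorem proposition1p10 {k A L : Type*} [Field k] [CharZero k] [CommRing A] [Algebra k A]
    [LieRing L] [LieAlgebra k L] [Module A L] [LieRingModule L A] [LieRinehartRing A L]
    [LieRinehartAlgebra k A L] (H : LieRinehartSubalgebra A L)
    [Module.Projective A H] [Module.Projective A L] [Module.Projective A (L ⧸ H.toSubmodule)] :
    Nonempty (LieRinehartUEA.UEA k A L ≃ₗ[LieRinehartUEA.UEA k A H]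
      LieRinehartUEA.RightReg k A H ⊗[A] SymmetricAlgebra A (L ⧸ H.toSubmodule)) ∧
    Module.Projective (LieRinehartUEA.UEA k A H) (LieRinehartUEA.UEA k A L) := by
  let : Algebra ℚ A := ((algebraMap k A).comp (algebraMap ℚ k)).toAlgebra
  exact proposition1p10_general H
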